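/- Let $q>1$ be an integer, let $\mathbf G=(\mathbb Z/q\mathbb Z)^\times$, and let $\mathscr G$ be the set of cyclic subgroups of $\mathbf G$. A *lattice-invariant class* is a set of the form $\{x\in\mathbf G:\langle x\rangle=K\}$ with $K\in\mathscr G$; let $\mathbf G^\sharp$ be the set of these classes, which is in bijection with $\mathscr G$ through $\mathcal A\mapsto\langle\mathcal A\rangle$. Let $\exp\mathbf G$ be the exponent of $\mathbf G$, let $d(n)$ be the number of positive divisors of $n$, and let $\mu$ be the Möbius function. For real $P\ge 2$, real $s>1$ and a Dirichlet character $\chi$ modulo $q$, put $L_P(s,\chi)=\prod_{p\ge P}(1-\chi(p)p^{-s})^{-1}$ (product over primes). For $t\ge1$ let $\Gamma_s(t)$ be the vector indexed by $G_0\in\mathscr G$ with entries $$\log\prod_{\chi\in G_0^\perp}L_P(ts,\chi),$$ where $G_0^\perp$ is the group of Dirichlet characters modulo $q$ that are equal to $1$ on $G_0$ (the product is a positive real number). Let $M_1^{-1}$ be the matrix with rows indexed by $\mathcal A\in\mathbf G^\sharp$ and columns by $K\in\mathscr G$, whose entry is $\mu(|\langle\mathcal A\rangle/K|)/|\mathbf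 G/K|$ if $K\subset\langle\mathcal A\rangle$ and $0$ otherwise. For each divisor $d>1$ of $\exp\mathbf G$ let $N_d$ be the matrix indexed by $\mathscr G\times\mathscr G$ with entries $$N_d\big|_{B_0,B_1}=\sum_{K\subset B_0,\ |KB_1/K|=d}\mu(|B_0/K|).$$ Identifying $\mathbf G^\sharp$ with $\mathscr G$, define for $r\ge2$ the positive numbers $\zeta_P(s;q,\mathcal A|r)$ by $$\bigl(\log\zeta_P(s;q,\mathcal A|r)\bigr)_{\mathcal A\in\mathbf G^\sharp}=\sum_{0\le v\le r-1}(-1)^v\sum_{d_1\cdots d_v\le 2^r}\frac{N_{d_1}}{d_1}\cdots\frac{N_{d_v}}{d_v}M_1^{-1}\Gamma_s(d_1\cdots d_v),$$ where $d_1,\dots,d_v$ range over the divisors of $\exp\mathbf G$ other than $1$ (for $v=0$ the inner sum is $M_1^{-1}\Gamma_s(1)$). For $F\in\mathbb R[X]$ with $F(0)=1$, let $\alpha_1,\dots,\alpha_\delta$ be the inverses of its complex roots, counted with multiplicity, and put $s_F(k)=\alpha_1^k+\dots+\alpha_\delta^k$ and $b_F(k)=\frac1k\sum_{d\mid k}\mu(k/d)\,s_F(d)$.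 These are real numbers. **Theorem.** Let $F,G\in\mathbb R[X]$ be two coprime polynomials with $F(0)=G(0)=1$ and $X^2\mid F-G$. Let $\beta\ge2$ be an upper bound for the moduli of the inverses of the complex roots of $F$ and of $G$, and let $P\ge2\beta$ be a real number. Let $\mathcal A\in\mathbf G^\sharp$. Then, for all integers $J\ge3$ and $r\ge2$, the product on the left below converges and $$\prod_{\substack{p\ge P\\ p\bmod q\,\in\mathcal A}}\frac{F(1/p)}{G(1/p)}=\prod_{2\le j\le J}\zeta_P(j;q,\mathcal A|r)^{b_G(j)-b_F(j)}\times I,$$ where $I>0$ satisfies $$|\log I|\le\max(\deg F,\deg G)\left(\left(\frac{|\mathbf G^\sharp|\,d(\exp\mathbf G)}{2}\right)^{r-1}\frac{r\beta^2}{P^{2^{r+1}}}\,(1+2^{-r}P)+\frac{4\beta^{J+1}}{J\,P^{J}}\right).$$ -/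

import Mathlib

namespace EulerProd

/-- The group `G = (ℤ/qℤ)ˣ`. -/
abbrev G (q : ℕ) : Type := (ZMod q)ˣ

/-- The set `𝒢` of cyclic subgroups of `G`. -/
abbrev CyclicSubgroup (q : ℕ) : Type := {K : Subgroup (G q) // IsCyclic K}

/-- The set of generators of a subgroup `K`. -/
def generators {q : ℕ} (K : Subgroup (G q)) : Set (G q) := {x | Subgroup.zpowers x = K}

/-- The set `G^♯` of lattice-invariant classes: the sets of all generators of a cyclic
subgroup of `G`. -/
abbrev LatticeClass (q : ℕ) : Type :=
  {A : Set (G q) // ∃ K : Subgroup (G q), IsCyclic K ∧ A = generators K}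

theorem closure_generators {q : ℕ} (K : Subgroup (G q)) (hK : IsCyclic K) :
    Subgroup.closure (generators K) = K := by
  apply le_antisymm
  · rw [Subgroup.closure_le]
    intro x hx
    have hx' : Subgroup.zpowers x = K := hx
    rw [← hx']
    exact Subgroup.mem_zpowers x
  · obtain ⟨g, hg⟩ := (Subgroup.isCyclic_iff_exists_zpowers_eq_top K).1 hK
    have h : g ∈ Subgroup.closure (generators K) := Subgroup.subset_closure hg
    exact hg.symm.le.trans ((Subgroup.zpowers_le).2 h)

/-- The cyclic subgroup `⟨A⟩` generated by a lattice-invariant class `A`. The map `A ↦ ⟨A⟩` is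
the bijection between lattice-invariant classes and cyclic subgroups. -/
def LatticeClass.span {q : ℕ} (A : LatticeClass q) : CyclicSubgroup q :=
  ⟨Subgroup.closure A.1, by
    obtain ⟨K, hK, hA⟩ := A.2
    rw [hA, closure_generators K hK]
    exact hK⟩

noncomputable instance (q : ℕ) [NeZero q] : Fintype (CyclicSubgroup q) := Fintype.ofFinite _

/-- `L_P(s, χ) = ∏_{p ≥ P} (1 - χ(p) / p ^ s)⁻¹`, over primes, for real `s > 1`. -/
noncomputable def LP {q : ℕ} (P s : ℝ) (χ : DirichletCharacter ℂ q) : ℂ :=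
  ∏' p : {p : ℕ // p.Prime ∧ P ≤ (p : ℝ)}, (1 - χ (p.1 : ZMod q) / (p.1 : ℂ) ^ (s : ℂ))⁻¹

open Classical in
/-- `G₀^⊥`: the Dirichlet characters modulo `q` that take the value `1` on `G₀`. -/
noncomputable def perp {q : ℕ} [NeZero q] (G₀ : Subgroup (G q)) :
    Finset (DirichletCharacter ℂ q) :=
  Finset.univ.filter fun χ => ∀ g ∈ G₀, χ (g : ZMod q) = 1

/-- `Γ_s(t)`, the vector with entries `γ_s(G₀, t) = log ∏_{χ ∈ G₀^⊥} L_P(t s, χ)`, for `G₀` a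
cyclic subgroup. The product is a positive real number, because `G₀^⊥` is stable under complex
conjugation; `re` only moves it from `ℂ` to `ℝ`. -/
noncomputable def Gam {q : ℕ} [NeZero q] (P s : ℝ) (t : ℕ) : CyclicSubgroup q → ℝ :=
  fun G₀ => Real.log (∏ χ ∈ perp G₀.1, LP P ((t : ℝ) * s) χ).re

open Classical in
/-- The matrix `M₁⁻¹`. Its rows are indexed by lattice-invariant classes `A`; the row of `A` is
given here the index `B = ⟨A⟩`. The entry is `μ(|B/K|) / |G/K|` if `K ⊆ B`, and `0` otherwise. -/
noncomputable def M1inv (q : ℕ) : Matrix (CyclicSubgroup q) (CyclicSubgroup q) ℝ :=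
  fun B K =>
    if K.1 ≤ B.1 then (ArithmeticFunction.moebius (K.1.relIndex B.1) : ℝ) / (K.1.index : ℝ)
    else 0

/-- The matrix `N_d`, with entries `∑ μ(|B₀/K|)` over the subgroups `K ⊆ B₀` such that
`|K B₁ / K| = d`. -/
noncomputable def N (q : ℕ) (d : ℕ) :
    Matrix (CyclicSubgroup q) (CyclicSubgroup q) ℝ :=
  fun B₀ B₁ =>
    ∑ᶠ K ∈ {K : Subgroup (G q) | K ≤ B₀.1 ∧ K.relIndex (K ⊔ B₁.1) = d},
      (ArithmeticFunction.moebius (K.relIndex B₀.1) : ℝ)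

/-- The exponent of `G`. -/
noncomputable def expG (q : ℕ) : ℕ := Monoid.exponent (G q)

/-- The tuples `(d₁, …, d_v)` of divisors of `exp G`, all distinct from `1`, such that
`d₁ ⋯ d_v ≤ 2 ^ r`. -/
noncomputable def tuples (q r v : ℕ) : Finset (Fin v → ℕ) :=
  (Fintype.piFinset fun _ : Fin v => (expG q).divisors.erase 1).filter
    fun d => ∏ i, d i ≤ 2 ^ r

open Classical in
/-- The vector
`∑_{0 ≤ v ≤ r-1} (-1)^v ∑_{d₁ ⋯ d_v ≤ 2^r} (N_{d₁}/d₁) ⋯ (N_{d_v}/d_v) M₁⁻¹ Γ_s(d₁ ⋯ d_v)`. -/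
noncomputable def approxVec (q : ℕ) [NeZero q] (P s : ℝ) (r : ℕ) : CyclicSubgroup q → ℝ :=
  ∑ v ∈ Finset.range r, (-1 : ℝ) ^ v • ∑ d ∈ tuples q r v,
    ((List.ofFn fun i : Fin v => ((d i : ℝ)⁻¹) • N q (d i)).prod * M1inv q).mulVec
      (Gam P s (∏ i, d i))

/-- `ζ_P(s; q, A | r)`. -/
noncomputable def zetaApprox {q : ℕ} [NeZero q] (P s : ℝ) (A : LatticeClass q) (r : ℕ) : ℝ :=
  Real.exp (approxVec q P s r A.span)

open Polynomial in
/-- `s_F(k) = α₁ ^ k + ⋯ + α_δ ^ k`, where the `α_i` are the inverses of the complex roots of `F`,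
counted with multiplicity. This sum is real, because `F` has real coefficients. -/
noncomputable def powerSum (F : ℝ[X]) (k : ℕ) : ℝ :=
  (((F.aroots ℂ).map fun ρ => ρ⁻¹ ^ k).sum).re

open Polynomial in
/-- `b_F(k) = (1/k) ∑_{d ∣ k} μ(k/d) s_F(d)`. -/
noncomputable def wittExp (F : ℝ[X]) (k : ℕ) : ℝ :=
  1 / (k : ℝ) * ∑ d ∈ k.divisors, (ArithmeticFunction.moebius (k / d) : ℝ) * powerSum F d

/-- The primes `p ≥ P` whose residue class modulo `q` lies in `A`. -/
abbrev PrimesIn {q : ℕ} (P : ℝ) (A : LatticeClass q) : Type :=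
  {p : ℕ // p.Prime ∧ P ≤ (p : ℝ) ∧ ∃ a ∈ A.1, (a : ZMod q) = (p : ZMod q)}

end EulerProd

/-! ### Elementary bounds for sums over large primes -/

namespace EulerProd

/-! Fix j ≥ 2 and let T(t) be the vector whose entry at a cyclic subgroup B is the sum of -log(1 -
p^(-tj)) over the primes p ≥ P whose class generates B. Summing -log(1 - χ(p)p^(-tj)) over χ ∈ K^⊥
keeps, by orthogonality, only the powers pⁿ lying in K, so Γ_j(t) is a combination of sums T(dt)
with d the order of p in G/K. Applying M₁⁻¹ and grouping by d gives M₁⁻¹Γ_j(t) = Σ_d (N_d/d) T(dt)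
over all d ∣ exp G (`M1inv_mulVec_Gam`).

Since N_1 is the identity, this reads T(t) = M₁⁻¹Γ_j(t) - Σ_{d>1} (N_d/d) T(dt). Iterating from t =
1, and stopping a branch once its product of divisors exceeds 2^r, yields exactly log ζ_P(j; q, A |
r) as an approximation of T(1) (`approxVec_eq`). The discarded terms involve T only at arguments at
least 2^r, hence are tiny; their matrices are controlled because every entry of N_d has modulus at
most 1 (`abs_N_apply_le`).

On the polynomial side, Möbius inversion turns the power series of log(F/G) into Σ_j (b_G(j) -
b_F(j))·(-log(1 - x^j)) (`hasSum_wittExp_sub`). The hypothesis on X² removes j = 1, and βx ≤ 1/2 at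
x = 1/p makes everything absolutely convergent, so the logarithm of the product is a series in the
A-entries of T(1), over j ≥ 2. Cutting it at J and replacing T(1) by its approximation for j ≤ J
produce the two terms of the bound. -/

theorem neg_log_one_sub_nonneg {x : ℝ} (h0 : 0 ≤ x) (h1 : x < 1) : 0 ≤ -Real.log (1 - x) :=
  neg_nonneg.2 (Real.log_nonpos (by linarith) (by linarith))

theorem neg_log_one_sub_le {x c : ℝ} (h0 : 0 ≤ x) (hc : x ≤ c) (h1 : c < 1) :
    -Real.log (1 - x) ≤ (1 - c)⁻¹ * x := by
  have hx : 0 < 1 - x := by linarith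
  have h := Real.one_sub_inv_le_log_of_pos hx
  have h2 : (1 - x)⁻¹ - 1 = (1 - x)⁻¹ * x := by field_simp; ring
  have h3 : (1 - x)⁻¹ ≤ (1 - c)⁻¹ := inv_anti₀ (by linarith) (by linarith)
  linarith [mul_le_mul_of_nonneg_right h3 h0]

/-- Bernoulli's inequality (1 - x)^t ≤ 1 - tx for exponents in [0, 1]. With t = p^(-k) it compares
the exponents u + k and u with no loss of constant. -/
theorem neg_log_one_sub_mul_le {x t : ℝ} (h1 : x < 1) (ht0 : 0 ≤ t) (ht1 : t ≤ 1) :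
    -Real.log (1 - t * x) ≤ t * -Real.log (1 - x) := by
  have h := rpow_one_add_le_one_add_mul_self (s := -x) (by linarith) ht0 ht1
  have hx : 0 < 1 + -x := by linarith
  have h2 := Real.log_le_log (Real.rpow_pos_of_pos hx t) h
  rw [Real.log_rpow hx] at h2
  rw [show 1 - t * x = 1 + t * -x by ring, sub_eq_add_neg]
  linarith

/-- The primes `p ≥ P`. -/
abbrev LargePrime (P : ℝ) : Type := {p : ℕ // p.Prime ∧ P ≤ (p : ℝ)}

section LargePrime

variable {P : ℝ} (hP : 4 ≤ P)
include hP

theorem LargePrime.four_le (p : LargePrime P) : (4 : ℝ) ≤ p.1 := hP.trans p.2.2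

theorem LargePrime.inv_pow_le (p : LargePrime P) {u : ℕ} (hu : 2 ≤ u) :
    1 / (p.1 : ℝ) ^ u ≤ 1 / 16 := by
  -- The constants 1/16 and 16/15 = (1 - 1/16)⁻¹ used throughout come from p ≥ 4 and u ≥ 2.
  have h4 := p.four_le hP
  apply one_div_le_one_div_of_le (by norm_num)
  calc (16 : ℝ) = 4 ^ 2 := by norm_num
    _ ≤ 4 ^ u := pow_le_pow_right₀ (by norm_num) hu
    _ ≤ (p.1 : ℝ) ^ u := pow_le_pow_left₀ (by norm_num) h4 u

theorem LargePrime.neg_log_nonneg (p : LargePrime P) {u : ℕ} (hu : 2 ≤ u) :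
    0 ≤ -Real.log (1 - 1 / (p.1 : ℝ) ^ u) :=
  neg_log_one_sub_nonneg (by positivity) ((p.inv_pow_le hP hu).trans_lt (by norm_num))

theorem LargePrime.neg_log_le (p : LargePrime P) {u : ℕ} (hu : 2 ≤ u) :
    -Real.log (1 - 1 / (p.1 : ℝ) ^ u) ≤ 16 / 15 * (1 / (p.1 : ℝ) ^ u) := by
  have h := neg_log_one_sub_le (x := 1 / (p.1 : ℝ) ^ u) (by positivity) (p.inv_pow_le hP hu)
    (by norm_num)
  norm_num at h ⊢
  exact h

omit hP in
theorem summable_largePrime_inv_pow {u : ℕ} (hu : 2 ≤ u) :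
    Summable fun p : LargePrime P => 1 / (p.1 : ℝ) ^ u :=
  (Real.summable_one_div_nat_pow.2 (by omega)).comp_injective Subtype.val_injective

theorem summable_largePrime_neg_log {u : ℕ} (hu : 2 ≤ u) :
    Summable fun p : LargePrime P => -Real.log (1 - 1 / (p.1 : ℝ) ^ u) :=
  .of_nonneg_of_le (fun p => p.neg_log_nonneg hP hu) (fun p => p.neg_log_le hP hu)
    ((summable_largePrime_inv_pow hu).mul_left _)

theorem LargePrime.neg_log_add_le (p : LargePrime P) {u : ℕ} (hu : 2 ≤ u) (k : ℕ) :
    -Real.log (1 - 1 / (p.1 : ℝ) ^ (u + k)) ≤ 1 / P ^ k * -Real.log (1 - 1 / (p.1 : ℝ) ^ u) := by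
  have h4 := p.four_le hP
  have hx : 1 / (p.1 : ℝ) ^ u < 1 := (p.inv_pow_le hP hu).trans_lt (by norm_num)
  have h := neg_log_one_sub_mul_le (x := 1 / (p.1 : ℝ) ^ u) (t := 1 / (p.1 : ℝ) ^ k)
    hx (by positivity)
    (div_le_one_of_le₀ (one_le_pow₀ (by linarith)) (by positivity))
  rw [show 1 / (p.1 : ℝ) ^ (u + k) = 1 / (p.1 : ℝ) ^ k * (1 / (p.1 : ℝ) ^ u) by
    rw [pow_add]; field_simp]
  refine h.trans (mul_le_mul_of_nonneg_right ?_ (p.neg_log_nonneg hP hu))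
  exact one_div_le_one_div_of_le (by positivity) (pow_le_pow_left₀ (by linarith) p.2.2 k)

end LargePrime

/-- The sum of `-log (1 - p⁻ᵘ)` over the primes `p ≥ P`. -/
noncomputable def primeTail (P : ℝ) (u : ℕ) : ℝ :=
  ∑' p : LargePrime P, -Real.log (1 - 1 / (p.1 : ℝ) ^ u)

theorem primeTail_nonneg {P : ℝ} (hP : 4 ≤ P) {u : ℕ} (hu : 2 ≤ u) : 0 ≤ primeTail P u :=
  tsum_nonneg fun p => p.neg_log_nonneg hP hu

theorem primeTail_add_le {P : ℝ} (hP : 4 ≤ P) {u : ℕ} (hu : 2 ≤ u) (k : ℕ) :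
    primeTail P (u + k) ≤ 1 / P ^ k * primeTail P u := by
  rw [primeTail, primeTail, ← tsum_mul_left]
  exact (summable_largePrime_neg_log hP (by omega)).tsum_le_tsum
    (fun p => p.neg_log_add_le hP hu k) ((summable_largePrime_neg_log hP hu).mul_left _)

/-- Bernoulli applied to (1 + 1/x)^m. This is the telescoping substitute for comparing a sum of
inverse powers with an integral. -/
theorem inv_pow_succ_le_sub {x : ℝ} (hx : 1 ≤ x) (m : ℕ) :
    m * (1 / (x + 1) ^ (m + 1)) ≤ 1 / x ^ m - 1 / (x + 1) ^ m := by
  have h0 : 0 < x := by linarith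
  have h := one_add_mul_le_pow (a := 1 / x) (by have : 0 ≤ 1 / x := by positivity
                                                linarith) m
  have h1 : (1 + 1 / x) ^ m = (x + 1) ^ m / x ^ m := by rw [← div_pow]; congr 1; field_simp
  rw [h1] at h
  have h2 : (m : ℝ) * (1 / (x + 1)) ≤ m * (1 / x) := by gcongr; linarith
  have h3 : 1 + (m : ℝ) * (1 / (x + 1)) ≤ (x + 1) ^ m / x ^ m := by linarith
  have h4 := mul_le_mul_of_nonneg_right h3 (show 0 ≤ 1 / (x + 1) ^ m by positivity)
  have h5 : (x + 1) ^ m / x ^ m * (1 / (x + 1) ^ m) = 1 / x ^ m := by field_simp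
  have h6 : (1 + (m : ℝ) * (1 / (x + 1))) * (1 / (x + 1) ^ m)
      = 1 / (x + 1) ^ m + m * (1 / (x + 1) ^ (m + 1)) := by rw [pow_succ]; field_simp
  linarith

theorem sum_range_inv_pow_le {x : ℝ} (hx : 1 ≤ x) {m : ℕ} (hm : 1 ≤ m) (n : ℕ) :
    ∑ i ∈ Finset.range n, 1 / (x + i) ^ (m + 1) ≤ 1 / x ^ (m + 1) + 1 / m * (1 / x ^ m) := by
  have key : ∀ n : ℕ, ∑ i ∈ Finset.range n, 1 / (x + (i + 1 : ℕ)) ^ (m + 1) ≤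
      1 / m * (1 / x ^ m - 1 / (x + n) ^ m) := by
    intro n
    induction n with
    | zero => simp
    | succ n ih =>
      rw [Finset.sum_range_succ]
      have h := inv_pow_succ_le_sub (x := x + n) (by have := n.cast_nonneg (α := ℝ); linarith) m
      have hm' : (0 : ℝ) < m := by exact_mod_cast hm
      rw [← le_div_iff₀' hm'] at h
      push_cast at h ih ⊢
      rw [← add_assoc]
      calc _ ≤ _ := add_le_add ih h
        _ = _ := by ring
  cases n with
  | zero => simp; positivity
  | succ n =>
    rw [Finset.sum_range_succ']
    have h := key n
    have h2 : 0 ≤ 1 / (m : ℝ) * (1 / (x + n) ^ m) := by positivity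
    rw [mul_sub] at h
    simp only [Nat.cast_zero, add_zero] at h ⊢
    linarith

/-- Primality is thrown away: the sum is enlarged to all integers from ⌈P⌉ on. -/
theorem tsum_largePrime_inv_pow_le {P : ℝ} (hP : 4 ≤ P) {m : ℕ} (hm : 1 ≤ m) :
    ∑' p : LargePrime P, 1 / (p.1 : ℝ) ^ (m + 1) ≤ 1 / P ^ (m + 1) * (1 + P / m) := by
  have hx : P ≤ (⌈P⌉₊ : ℝ) := Nat.le_ceil P
  have hm' : (0 : ℝ) < m := by exact_mod_cast hm
  have hn : ∀ p : LargePrime P, ⌈P⌉₊ ≤ p.1 := fun p => Nat.ceil_le.2 p.2.2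
  have hb := sum_range_inv_pow_le (x := ⌈P⌉₊) (by linarith) hm
  have hs := summable_of_sum_range_le (fun n => by positivity) hb
  calc ∑' p : LargePrime P, 1 / (p.1 : ℝ) ^ (m + 1)
      ≤ ∑' i : ℕ, 1 / ((⌈P⌉₊ : ℝ) + i) ^ (m + 1) := by
        refine Summable.tsum_le_tsum_of_inj (fun p : LargePrime P => p.1 - ⌈P⌉₊) ?_ ?_ ?_
          (summable_largePrime_inv_pow (by omega)) hs
        · intro p p' h
          have := hn p; have := hn p'
          apply Subtype.ext
          dsimp only at h
          omega
        · intro c _; positivity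
        · intro p
          rw [Nat.cast_sub (hn p)]
          simp
    _ ≤ 1 / (⌈P⌉₊ : ℝ) ^ (m + 1) + 1 / m * (1 / (⌈P⌉₊ : ℝ) ^ m) :=
        Real.tsum_le_of_sum_range_le (fun n => by positivity) hb
    _ ≤ 1 / P ^ (m + 1) + 1 / m * (1 / P ^ m) := by gcongr
    _ = 1 / P ^ (m + 1) * (1 + P / m) := by
        rw [pow_succ]; field_simp

theorem primeTail_le {P : ℝ} (hP : 4 ≤ P) {m : ℕ} (hm : 1 ≤ m) :
    primeTail P (m + 1) ≤ 16 / 15 * (1 / P ^ (m + 1) * (1 + P / m)) := by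
  refine le_trans ?_ (mul_le_mul_of_nonneg_left (tsum_largePrime_inv_pow_le hP hm) (by norm_num))
  rw [primeTail, ← tsum_mul_left]
  exact (summable_largePrime_neg_log hP (by omega)).tsum_le_tsum
    (fun p => p.neg_log_le hP (by omega)) ((summable_largePrime_inv_pow (by omega)).mul_left _)

end EulerProd

/-! ### The entries of the matrices N_d -/

namespace EulerProd

/-- If φ(n) = Σ_{i ∣ n} ψ₀(i), then φ(gcd(c, n)) is the same sum restricted to i ∣ c. Möbius
inversion at b returns the restricted ψ₀(b), which is 0 because b does not divide c. -/
theorem sum_moebius_mul_gcd_eq_zero {b c : ℕ} (hb : b ≠ 0) (hc : c ∣ b) (hcb : c ≠ b)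
    (φ : ℕ → ℝ) :
    ∑ k ∈ b.divisors, (ArithmeticFunction.moebius (b / k) : ℝ) * φ (c.gcd k) = 0 := by
  have hc0 : c ≠ 0 := ne_zero_of_dvd_ne_zero hb hc
  set ψ₀ : ℕ → ℝ := fun d => ∑ x ∈ d.divisorsAntidiagonal,
    (ArithmeticFunction.moebius x.1 : ℝ) * φ x.2
  have h0 : ∀ n > 0, ∑ i ∈ n.divisors, ψ₀ i = φ n :=
    ArithmeticFunction.sum_eq_iff_sum_mul_moebius_eq.2 fun n _ => rfl
  have h1 : ∀ n > 0, ∑ i ∈ n.divisors, (if i ∣ c then ψ₀ i else 0) = φ (c.gcd n) := by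
    intro n hn
    rw [← h0 _ (Nat.gcd_pos_of_pos_right _ hn), ← Finset.sum_filter]
    congr 1
    ext i
    simp [Nat.dvd_gcd_iff, hn.ne', hc0]
    tauto
  have h2 := ArithmeticFunction.sum_eq_iff_sum_mul_moebius_eq.1 h1 b (Nat.pos_of_ne_zero hb)
  rw [if_neg fun h => hcb (Nat.dvd_antisymm hc h)] at h2
  rw [← h2, Nat.sum_divisorsAntidiagonal' fun i j =>
    (ArithmeticFunction.moebius i : ℝ) * φ (c.gcd j)]

theorem card_mul_relIndex_of_le {H : Type*} [Group H] {K B : Subgroup H} (h : K ≤ B) :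
    Nat.card K * K.relIndex B = Nat.card B := by
  have := Subgroup.relIndex_mul_relIndex ⊥ K B bot_le h
  rwa [Subgroup.relIndex_bot_left, Subgroup.relIndex_bot_left] at this

theorem card_ker_powMonoidHom_inf {H : Type*} [CommGroup H] [Finite H] (B : Subgroup H)
    [IsCyclic B] (k : ℕ) :
    Nat.card ↥((powMonoidHom k : H →* H).ker ⊓ B) = (Nat.card B).gcd k := by
  rw [← IsCyclic.card_powMonoidHom_ker]
  refine Nat.card_congr
    { toFun := fun x => ⟨⟨x.1, x.2.2⟩, ?_⟩
      invFun := fun x => ⟨x.1.1, ?_, x.1.2⟩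
      left_inv := fun x => rfl
      right_inv := fun x => rfl }
  · have h : x.1 ∈ (powMonoidHom k : H →* H).ker := x.2.1
    rw [MonoidHom.mem_ker] at h ⊢
    exact Subtype.ext h
  · have := x.2
    rw [MonoidHom.mem_ker] at this
    exact congrArg Subtype.val this

theorem eq_ker_powMonoidHom_inf {H : Type*} [CommGroup H] [Finite H] {K B : Subgroup H}
    [IsCyclic B] (h : K ≤ B) : K = (powMonoidHom (Nat.card K) : H →* H).ker ⊓ B := by
  refine Subgroup.eq_of_le_of_card_ge (le_inf (fun x hx => ?_) h) ?_
  · rw [MonoidHom.mem_ker]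
    exact congrArg Subtype.val (pow_card_eq_one' (x := (⟨x, hx⟩ : K)))
  · rw [card_ker_powMonoidHom_inf, Nat.gcd_eq_right (Subgroup.card_dvd_of_le h)]

instance {q : ℕ} (B : CyclicSubgroup q) : IsCyclic B.1 := B.2

variable {q : ℕ}

theorem relIndex_sup_eq (K B : Subgroup (G q)) : K.relIndex (K ⊔ B) = K.relIndex B :=
  Subgroup.relIndex_sup_left _ _

theorem relIndex_mem_divisors_expG (K : Subgroup (G q)) (B : CyclicSubgroup q) :
    K.relIndex B.1 ∈ (expG q).divisors := by
  rw [Nat.mem_divisors]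
  refine ⟨(Subgroup.relIndex_dvd_card K B.1).trans ?_, Monoid.exponent_ne_zero_of_finite⟩
  rw [← IsCyclic.exponent_eq_card]
  exact Monoid.exponent_dvd_of_monoidHom B.1.subtype B.1.subtype_injective

/-- A subgroup K of the cyclic group B₀ is its k-torsion, k = |K|. So K ∩ B₁ is the k-torsion of B₀
∩ B₁, of order gcd(|B₀ ∩ B₁|, k), and |KB₁/K| = |B₁/(K ∩ B₁)| becomes a condition on k alone. -/
theorem N_apply_eq_sum_divisors (d : ℕ) (B₀ B₁ : CyclicSubgroup q) :
    N q d B₀ B₁ = ∑ k ∈ (Nat.card B₀.1).divisors,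
      (ArithmeticFunction.moebius (Nat.card B₀.1 / k) : ℝ) *
        if (Nat.card ↥(B₀.1 ⊓ B₁.1)).gcd k * d = Nat.card B₁.1 then 1 else 0 := by
  have hcyc : IsCyclic ↥(B₀.1 ⊓ B₁.1) :=
    isCyclic_of_injective (Subgroup.inclusion (inf_le_left : B₀.1 ⊓ B₁.1 ≤ B₀.1))
      (Subgroup.inclusion_injective _)
  have hrel : ∀ K : Subgroup (G q), K ≤ B₀.1 →
      (Nat.card ↥(B₀.1 ⊓ B₁.1)).gcd (Nat.card K) * K.relIndex (K ⊔ B₁.1) = Nat.card B₁.1 := by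
    intro K hK
    rw [relIndex_sup_eq, ← Subgroup.inf_relIndex_right, ← card_ker_powMonoidHom_inf, ← inf_assoc,
      ← eq_ker_powMonoidHom_inf hK, card_mul_relIndex_of_le inf_le_right]
  simp only [mul_ite, mul_one, mul_zero]
  rw [← Finset.sum_filter, ← finsum_mem_coe_finset, N]
  refine finsum_mem_eq_of_bijOn (fun K => Nat.card K) ⟨?_, ?_, ?_⟩ ?_
  · rintro K ⟨hK, rfl⟩
    simp only [Finset.coe_filter, Nat.mem_divisors, Set.mem_ofPred_eq]
    exact ⟨⟨Subgroup.card_dvd_of_le hK, Nat.card_pos.ne'⟩, hrel K hK⟩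
  · rintro K ⟨hK, -⟩ K' ⟨hK', -⟩ h
    dsimp only at h
    rw [eq_ker_powMonoidHom_inf hK, eq_ker_powMonoidHom_inf hK', h]
  · intro k hk
    simp only [Finset.coe_filter, Nat.mem_divisors, Set.mem_ofPred_eq] at hk
    have hcard : Nat.card ↥((powMonoidHom k : G q →* G q).ker ⊓ B₀.1) = k := by
      rw [card_ker_powMonoidHom_inf, Nat.gcd_eq_right hk.1.1]
    refine ⟨_, ⟨inf_le_right, ?_⟩, hcard⟩
    have h := hrel _ (inf_le_right : (powMonoidHom k : G q →* G q).ker ⊓ B₀.1 ≤ B₀.1)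
    rw [hcard, ← hk.2] at h
    refine Nat.eq_of_mul_eq_mul_left (Nat.pos_of_ne_zero fun h0 => ?_) h
    rw [h0, zero_mul] at hk
    exact Nat.card_pos.ne hk.2
  · rintro K ⟨hK, -⟩
    rw [← card_mul_relIndex_of_le hK, Nat.mul_div_cancel_left _ Nat.card_pos]

theorem N_apply_eq_zero (d : ℕ) {B₀ B₁ : CyclicSubgroup q} (h : ¬ B₀.1 ≤ B₁.1) :
    N q d B₀ B₁ = 0 := by
  rw [N_apply_eq_sum_divisors]
  refine sum_moebius_mul_gcd_eq_zero Nat.card_pos.ne' (Subgroup.card_dvd_of_le inf_le_left)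
    (fun hc => h ?_) fun m => if m * d = Nat.card B₁.1 then 1 else 0
  rw [← inf_eq_left]
  exact Subgroup.eq_of_le_of_card_ge inf_le_left hc.ge

theorem N_apply_of_le (d : ℕ) {B₀ B₁ : CyclicSubgroup q} (h : B₀.1 ≤ B₁.1) :
    N q d B₀ B₁ = ∑ k ∈ (Nat.card B₀.1).divisors, if k * d = Nat.card B₁.1 then
      (ArithmeticFunction.moebius (Nat.card B₀.1 / k) : ℝ) else 0 := by
  rw [N_apply_eq_sum_divisors, inf_eq_left.2 h]
  refine Finset.sum_congr rfl fun k hk => ?_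
  rw [Nat.gcd_eq_right (Nat.dvd_of_mem_divisors hk), mul_ite, mul_one, mul_zero]

/-- When B₀ ≤ B₁ the condition kd = |B₁| leaves at most one Möbius value; otherwise the entry
vanishes. -/
theorem abs_N_apply_le (d : ℕ) (B₀ B₁ : CyclicSubgroup q) : |N q d B₀ B₁| ≤ 1 := by
  by_cases h : B₀.1 ≤ B₁.1
  · rw [N_apply_of_le d h, ← Finset.sum_filter]
    have hs : ∀ k k' : ℕ, k * d = Nat.card B₁.1 → k' * d = Nat.card B₁.1 → k = k' := by
      intro k k' hk hk'
      have hd : 0 < d := Nat.pos_of_ne_zero fun h0 => by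
        rw [h0, mul_zero] at hk
        exact Nat.card_pos.ne hk
      exact Nat.eq_of_mul_eq_mul_right hd (hk.trans hk'.symm)
    set S := (Nat.card B₀.1).divisors.filter fun k => k * d = Nat.card B₁.1
    have hcard : S.card ≤ 1 := Finset.card_le_one.2 fun k hk k' hk' =>
      hs k k' (Finset.mem_filter.1 hk).2 (Finset.mem_filter.1 hk').2
    calc _ ≤ ∑ k ∈ S, |(ArithmeticFunction.moebius (Nat.card B₀.1 / k) : ℝ)| :=
          Finset.abs_sum_le_sum_abs _ _
      _ ≤ ∑ k ∈ S, (1 : ℝ) := Finset.sum_le_sum fun k _ => by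
          exact_mod_cast ArithmeticFunction.abs_moebius_le_one
      _ ≤ 1 := by simpa using mod_cast hcard
  · rw [N_apply_eq_zero d h, abs_zero]
    exact zero_le_one

open Classical in
theorem N_one : N q 1 = 1 := by
  ext B₀ B₁
  by_cases h : B₀.1 ≤ B₁.1
  · rw [N_apply_of_le 1 h]
    simp only [mul_one]
    rw [Finset.sum_ite_eq']
    have hiff : Nat.card B₁.1 ∈ (Nat.card B₀.1).divisors ↔ B₀ = B₁ := by
      constructor
      · intro hd
        exact Subtype.ext (Subgroup.eq_of_le_of_card_ge h
          (Nat.le_of_dvd Nat.card_pos (Nat.dvd_of_mem_divisors hd)))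
      · rintro rfl
        exact Nat.mem_divisors_self _ Nat.card_pos.ne'
    by_cases hB : B₀ = B₁
    · rw [if_pos (hiff.2 hB), hB, Nat.div_self Nat.card_pos, Matrix.one_apply_eq]
      simp
    · rw [if_neg (mt hiff.1 hB), Matrix.one_apply_ne hB]
  · rw [N_apply_eq_zero 1 h, Matrix.one_apply_ne]
    rintro rfl
    exact h le_rfl

variable [NeZero q]

theorem N_apply_eq_sum (d : ℕ) (B₀ B₁ : CyclicSubgroup q) :
    N q d B₀ B₁ = ∑ K : CyclicSubgroup q, open Classical in
      if K.1 ≤ B₀.1 ∧ K.1.relIndex B₁.1 = d then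
        (ArithmeticFunction.moebius (K.1.relIndex B₀.1) : ℝ) else 0 := by
  classical
  rw [← Finset.sum_filter, ← finsum_mem_coe_finset, N]
  symm
  refine finsum_mem_eq_of_bijOn Subtype.val ⟨?_, Subtype.val_injective.injOn, ?_⟩ fun K _ => rfl
  · intro K hK
    simpa [relIndex_sup_eq] using hK
  · rintro K ⟨hK, hd⟩
    refine ⟨⟨K, isCyclic_of_injective (Subgroup.inclusion hK)
      (Subgroup.inclusion_injective _)⟩, ?_, rfl⟩
    rw [relIndex_sup_eq] at hd
    simpa using ⟨hK, hd⟩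

end EulerProd

/-! ### Character sums and the identity for M₁⁻¹Γ -/

namespace EulerProd

variable {q : ℕ}

/-- The residue class of `p` modulo `q` generates the cyclic subgroup `B`. -/
def IsGenerator (p : ℕ) (B : CyclicSubgroup q) : Prop :=
  ∃ a ∈ generators B.1, (a : ZMod q) = (p : ZMod q)

open Classical in
/-- The sum of `-log (1 - p⁻ᵘ)` over the primes `p ≥ P` whose residue class generates `B`. -/
noncomputable def classTail (P : ℝ) (B : CyclicSubgroup q) (u : ℕ) : ℝ :=
  ∑' p : LargePrime P, if IsGenerator p.1 B then -Real.log (1 - 1 / (p.1 : ℝ) ^ u) else 0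

theorem isGenerator_iff {p : ℕ} {a : G q} (ha : (a : ZMod q) = (p : ZMod q))
    (B : CyclicSubgroup q) : IsGenerator p B ↔ B = ⟨Subgroup.zpowers a, inferInstance⟩ := by
  constructor
  · rintro ⟨b, hb, hbp⟩
    obtain rfl : b = a := Units.ext (hbp.trans ha.symm)
    exact Subtype.ext (Eq.symm hb)
  · rintro rfl
    exact ⟨a, rfl, ha⟩

open Classical in
theorem sum_ite_isGenerator [NeZero q] {p : ℕ} {a : G q} (ha : (a : ZMod q) = (p : ZMod q))
    (f : CyclicSubgroup q → ℝ) :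
    ∑ B : CyclicSubgroup q, (if IsGenerator p B then f B else 0) =
      f ⟨Subgroup.zpowers a, inferInstance⟩ := by
  simp only [isGenerator_iff ha]
  rw [Finset.sum_ite_eq']
  simp

open Classical in
theorem sum_ite_isGenerator_le [NeZero q] (p : ℕ) {x : ℝ} (hx : 0 ≤ x) :
    ∑ B : CyclicSubgroup q, (if IsGenerator p B then x else 0) ≤ x := by
  by_cases h : ∃ a : G q, (a : ZMod q) = (p : ZMod q)
  · obtain ⟨a, ha⟩ := h
    rw [sum_ite_isGenerator ha]
  · rw [Finset.sum_eq_zero fun B _ => if_neg fun ⟨a, _, ha⟩ => h ⟨a, ha⟩]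
    exact hx

section Tail

variable {P : ℝ} (hP : 4 ≤ P) {u : ℕ} (hu : 2 ≤ u)
include hP hu

open Classical in
theorem summable_classTail (B : CyclicSubgroup q) : Summable fun p : LargePrime P =>
    if IsGenerator p.1 B then -Real.log (1 - 1 / (p.1 : ℝ) ^ u) else 0 := by
  refine .of_nonneg_of_le (fun p => ?_) (fun p => ?_) (summable_largePrime_neg_log hP hu) <;>
  have := p.neg_log_nonneg hP hu <;> split_ifs <;> first | exact le_rfl | exact this

theorem classTail_nonneg (B : CyclicSubgroup q) : 0 ≤ classTail P B u := by
  refine tsum_nonneg fun p => ?_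
  have := p.neg_log_nonneg hP hu
  split_ifs <;> first | exact le_rfl | exact this

theorem sum_classTail_le [NeZero q] : ∑ B : CyclicSubgroup q, classTail P B u ≤ primeTail P u := by
  classical
  simp only [classTail]
  rw [← Summable.tsum_finsetSum fun B _ => summable_classTail hP hu B]
  exact (summable_sum fun B _ => summable_classTail hP hu B).tsum_le_tsum
    (fun p => sum_ite_isGenerator_le p.1 (p.neg_log_nonneg hP hu))
    (summable_largePrime_neg_log hP hu)

end Tail

/-- The relative index is the order of g in the quotient by K. -/
theorem pow_mem_iff_relIndex_dvd {H : Type*} [CommGroup H] (K : Subgroup H) (g : H) (n : ℕ) :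
    g ^ n ∈ K ↔ K.relIndex (Subgroup.zpowers g) ∣ n := by
  have h : K.relIndex (Subgroup.zpowers g) = orderOf (g : H ⧸ K) := by
    conv_lhs => rw [← QuotientGroup.ker_mk' K]
    rw [Subgroup.relIndex_ker, MonoidHom.map_zpowers, Nat.card_zpowers]
    rfl
  rw [h, orderOf_dvd_iff_pow_eq_one, ← QuotientGroup.mk_pow, QuotientGroup.eq_one_iff]

theorem norm_char_mul_le {P : ℝ} (u : ℕ) (χ : DirichletCharacter ℂ q) (p : LargePrime P) :
    ‖χ (p.1 : ZMod q) * ((1 / (p.1 : ℝ) ^ u : ℝ) : ℂ)‖ ≤ 1 / (p.1 : ℝ) ^ u := by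
  rw [norm_mul, Complex.norm_real, Real.norm_of_nonneg (by positivity)]
  exact mul_le_of_le_one_left (by positivity) (χ.norm_le_one _)

theorem summable_log_char {P : ℝ} {u : ℕ} (hu : 2 ≤ u) (χ : DirichletCharacter ℂ q) : Summable fun p : LargePrime P =>
    -Complex.log (1 - χ (p.1 : ZMod q) * ((1 / (p.1 : ℝ) ^ u : ℝ) : ℂ)) := by
  have h := Complex.summable_log_one_add_of_summable
    (f := fun p : LargePrime P => -(χ (p.1 : ZMod q) * ((1 / (p.1 : ℝ) ^ u : ℝ) : ℂ)))
    (Summable.neg (.of_norm_bounded (summable_largePrime_inv_pow hu) fun p =>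
      norm_char_mul_le u χ p))
  simpa only [sub_eq_add_neg] using h.neg

theorem LP_eq_exp {P : ℝ} (hP : 4 ≤ P) {u : ℕ} (hu : 2 ≤ u) (χ : DirichletCharacter ℂ q) :
    LP P (u : ℝ) χ = Complex.exp
    (∑' p : LargePrime P,
      -Complex.log (1 - χ (p.1 : ZMod q) * ((1 / (p.1 : ℝ) ^ u : ℝ) : ℂ))) := by
  rw [← ((summable_log_char hu χ).hasSum.cexp).tprod_eq, LP]
  refine tprod_congr fun p => ?_
  have hlt : ‖χ (p.1 : ZMod q) * ((1 / (p.1 : ℝ) ^ u : ℝ) : ℂ)‖ < 1 :=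
    (norm_char_mul_le u χ p).trans_lt ((LargePrime.inv_pow_le hP p hu).trans_lt (by norm_num))
  rw [Function.comp_apply, Complex.exp_neg, Complex.exp_log]
  · congr 2
    push_cast
    rw [Complex.cpow_natCast, mul_one_div]
  · intro h0
    rw [← sub_eq_zero.1 h0] at hlt
    simp at hlt

variable [NeZero q]

theorem mem_perp {K : Subgroup (G q)} {χ : DirichletCharacter ℂ q} :
    χ ∈ perp K ↔ ∀ g ∈ K, χ (g : ZMod q) = 1 := by
  simp [perp]

theorem card_perp (K : Subgroup (G q)) : (perp K).card = K.index := by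
  have h := MulChar.card_subgroupOrderIsoSubgroupMulChar (M := ZMod q) (R := ℂ) (H := K)
  rw [Subgroup.index, ← h, ← Nat.card_eq_finsetCard]
  refine Nat.card_congr (Equiv.subtypeEquivRight fun χ => ?_)
  rw [mem_perp]
  exact MulChar.mem_subgroupOrderIsoSubgroupMulChar_iff.symm

theorem exists_mem_perp_apply_ne_one {K : Subgroup (G q)} {g : G q} (hg : g ∉ K) :
    ∃ χ ∈ perp K, χ (g : ZMod q) ≠ 1 := by
  by_contra! h
  refine hg ?_
  rw [← (MulChar.subgroupOrderIsoSubgroupMulChar (ZMod q) ℂ).symm_apply_apply K]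
  refine MulChar.mem_subgroupOrderIsoSubgroupMulChar_symm_iff.2 fun χ hχ => h χ (mem_perp.2 ?_)
  exact MulChar.mem_subgroupOrderIsoSubgroupMulChar_iff.1 hχ

open Classical in
-- Orthogonality: if some χ ∈ K^⊥ is not 1 at g, multiplication by χ permutes K^⊥ and forces the sum
-- to vanish.
theorem sum_perp_apply (K : Subgroup (G q)) (g : G q) :
    ∑ χ ∈ perp K, χ (g : ZMod q) = if g ∈ K then (K.index : ℂ) else 0 := by
  split_ifs with hg
  · rw [Finset.sum_congr rfl fun χ hχ => mem_perp.1 hχ g hg, ← card_perp]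
    simp
  · obtain ⟨χ, hχ, hχg⟩ := exists_mem_perp_apply_ne_one hg
    refine eq_zero_of_mul_eq_self_left hχg ?_
    rw [Finset.mul_sum]
    refine Finset.sum_bij' (fun ψ _ => χ * ψ) (fun ψ _ => χ⁻¹ * ψ) ?_ ?_ ?_ ?_ ?_
    · intro ψ hψ
      rw [mem_perp] at *
      intro k hk
      rw [MulChar.mul_apply, hχ k hk, hψ k hk, mul_one]
    · intro ψ hψ
      rw [mem_perp] at *
      intro k hk
      rw [MulChar.mul_apply, MulChar.inv_apply_eq_inv, hχ k hk, hψ k hk, mul_one]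
      simp
    · intro ψ _; simp
    · intro ψ _; simp
    · intro ψ _; rfl

/-- In the Taylor series of the logarithms, orthogonality keeps only the exponents n with gⁿ ∈ K,
that is the multiples of f, the order of g modulo K. What remains is the series of -log(1 - x^f),
scaled by index/f. -/
theorem sum_perp_neg_log (K : Subgroup (G q)) (g : G q) {x : ℝ} (h0 : 0 ≤ x) (h1 : x < 1) :
    ∑ χ ∈ perp K, -Complex.log (1 - χ (g : ZMod q) * x) =
      (((K.index : ℝ) / (K.relIndex (Subgroup.zpowers g)) *
        -Real.log (1 - x ^ K.relIndex (Subgroup.zpowers g)) : ℝ) : ℂ) := by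
  classical
  set f := K.relIndex (Subgroup.zpowers g)
  have hf : f ≠ 0 := Subgroup.index_ne_zero_of_finite
  have hnorm : ∀ χ : DirichletCharacter ℂ q, ‖χ (g : ZMod q) * x‖ < 1 := fun χ => by
    rw [norm_mul, DirichletCharacter.unit_norm_eq_one, one_mul, Complex.norm_real,
      Real.norm_of_nonneg h0]
    exact h1
  have hL := hasSum_sum (s := perp K) fun χ _ => Complex.hasSum_taylorSeries_neg_log (hnorm χ)
  have hxf : ‖((x ^ f : ℝ) : ℂ)‖ < 1 := by
    rw [Complex.norm_real, Real.norm_of_nonneg (by positivity)]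
    exact pow_lt_one₀ h0 h1 hf
  have hR := (Complex.hasSum_taylorSeries_neg_log hxf).mul_left ((K.index : ℂ) / f)
  have hinj : Function.Injective fun n : ℕ => f * n := fun m n h =>
    Nat.eq_of_mul_eq_mul_left (Nat.pos_of_ne_zero hf) h
  have hterm : ∀ n : ℕ, ∑ χ ∈ perp K, (χ (g : ZMod q) * x) ^ n / n =
      if f ∣ n then (K.index : ℂ) * x ^ n / n else 0 := by
    intro n
    have h := sum_perp_apply K (g ^ n)
    rw [pow_mem_iff_relIndex_dvd] at h
    simp only [Units.val_pow_eq_pow_val, map_pow] at h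
    simp only [mul_pow, ← Finset.sum_div, ← Finset.sum_mul, h, ite_mul, ite_div, zero_mul,
      zero_div]
    rfl
  simp only [hterm] at hL
  rw [← hinj.hasSum_iff] at hL
  · have hfun : ((fun n : ℕ => if f ∣ n then (K.index : ℂ) * x ^ n / n else 0) ∘ fun n => f * n) =
        fun n : ℕ => (K.index : ℂ) / f * (((x ^ f : ℝ) : ℂ) ^ n / n) := by
      funext n
      rw [Function.comp_apply, if_pos (dvd_mul_right f n), pow_mul]
      push_cast
      exact (div_mul_div_comm _ _ _ _).symm
    rw [hfun] at hL
    rw [hL.unique hR, ← Complex.ofReal_one, ← Complex.ofReal_sub, ← Complex.ofReal_log]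
    · push_cast
      rfl
    · rw [Complex.norm_real] at hxf
      linarith [(abs_lt.1 hxf).2]
  · intro n hn
    rw [if_neg]
    rintro ⟨m, rfl⟩
    exact hn ⟨m, rfl⟩

section LP

variable {P : ℝ} (hP : 4 ≤ P) {u : ℕ} (hu : 2 ≤ u)
include hP hu

open Classical in
theorem sum_perp_neg_log_prime (K : Subgroup (G q)) (p : LargePrime P) :
    ∑ χ ∈ perp K, -Complex.log (1 - χ (p.1 : ZMod q) * ((1 / (p.1 : ℝ) ^ u : ℝ) : ℂ)) =
      ((∑ B : CyclicSubgroup q, (K.index : ℝ) / K.relIndex B.1 * (if IsGenerator p.1 B then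
        -Real.log (1 - 1 / (p.1 : ℝ) ^ (K.relIndex B.1 * u)) else 0) : ℝ) : ℂ) := by
  have hlt : 1 / (p.1 : ℝ) ^ u < 1 := (p.inv_pow_le hP hu).trans_lt (by norm_num)
  by_cases h : ∃ a : G q, (a : ZMod q) = (p.1 : ZMod q)
  · obtain ⟨a, ha⟩ := h
    simp only [mul_ite, mul_zero]
    rw [sum_ite_isGenerator ha, ← ha, sum_perp_neg_log K a (by positivity) hlt]
    simp only [div_pow, one_pow, ← pow_mul, mul_comm u]
  -- A prime dividing q generates no B and is killed by every character, so both sides are 0.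
  · have hnot : ∀ B : CyclicSubgroup q, ¬ IsGenerator p.1 B := fun B ⟨a, _, ha⟩ => h ⟨a, ha⟩
    have hu' : ¬ IsUnit (p.1 : ZMod q) := fun ⟨a, ha⟩ => h ⟨a, ha⟩
    simp [hnot, MulChar.map_nonunit _ hu']

theorem Gam_eq_sum {j t : ℕ} (htj : t * j = u) (K : CyclicSubgroup q) :
    Gam P (j : ℝ) t K = ∑ B : CyclicSubgroup q,
      (K.1.index : ℝ) / K.1.relIndex B.1 * classTail P B (K.1.relIndex B.1 * u) := by
  classical
  have hcast : (t : ℝ) * (j : ℝ) = (u : ℝ) := by exact_mod_cast htj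
  have hf : ∀ B : CyclicSubgroup q, 2 ≤ K.1.relIndex B.1 * u := fun B => by
    have : 0 < K.1.relIndex B.1 := Nat.pos_of_ne_zero Subgroup.index_ne_zero_of_finite
    nlinarith
  rw [Gam, hcast, Finset.prod_congr rfl fun χ _ => LP_eq_exp hP hu χ, ← Complex.exp_sum,
    ← Summable.tsum_finsetSum fun χ _ => summable_log_char hu χ,
    tsum_congr (sum_perp_neg_log_prime hP hu K.1), ← Complex.ofReal_tsum, ← Complex.ofReal_exp,
    Complex.ofReal_re, Real.log_exp,
    Summable.tsum_finsetSum fun B _ => (summable_classTail hP (hf B) B).mul_left _]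
  exact Finset.sum_congr rfl fun B _ => tsum_mul_left

/-- The factor |G/K| of Γ cancels the denominator in M₁⁻¹. Sorting the K ≤ B₀ by d, their relative
index in B, then collects the Möbius values into N_d. -/
theorem M1inv_mulVec_Gam {j t : ℕ} (htj : t * j = u) :
    (M1inv q).mulVec (Gam P (j : ℝ) t) = ∑ d ∈ (expG q).divisors,
      (d : ℝ)⁻¹ • (N q d).mulVec fun B => classTail P B (d * u) := by
  classical
  funext B₀
  have hidx : ∀ K : CyclicSubgroup q, (K.1.index : ℝ) ≠ 0 := fun K =>
    Nat.cast_ne_zero.2 Subgroup.index_ne_zero_of_finite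
  simp only [Finset.sum_apply, Pi.smul_apply, smul_eq_mul, Matrix.mulVec, dotProduct,
    N_apply_eq_sum, Finset.mul_sum, Finset.sum_mul, Gam_eq_sum hP hu htj]
  rw [Finset.sum_comm]
  conv_rhs => rw [Finset.sum_comm]
  refine Finset.sum_congr rfl fun B _ => ?_
  rw [Finset.sum_comm]
  refine Finset.sum_congr rfl fun K _ => ?_
  rw [Finset.sum_eq_single_of_mem _ (relIndex_mem_divisors_expG K.1 B)]
  · by_cases hK : K.1 ≤ B₀.1
    · have := hidx K
      rw [M1inv, if_pos hK, if_pos ⟨hK, rfl⟩]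
      field_simp
    · rw [M1inv, if_neg hK, if_neg fun h => hK h.1]
      simp
  · intro d _ hd
    rw [if_neg fun h => hd h.2.symm]
    simp

end LP

end EulerProd

/-! ### Iterating the recursion and bounding its remainder -/

namespace EulerProd

variable {q : ℕ}

theorem pos_of_mem_tuples {r v : ℕ} {d : Fin v → ℕ} (hd : d ∈ tuples q r v) (i : Fin v) :
    0 < d i := by
  rw [tuples, Finset.mem_filter, Fintype.mem_piFinset] at hd
  exact Nat.pos_of_mem_divisors (Finset.mem_of_mem_erase (hd.1 i))

theorem prod_pos_of_mem_tuples {r v : ℕ} {d : Fin v → ℕ} (hd : d ∈ tuples q r v) :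
    0 < ∏ i, d i :=
  Finset.prod_pos fun i _ => pos_of_mem_tuples hd i

theorem two_le_of_mem_erase {d : ℕ} (hd : d ∈ (expG q).divisors.erase 1) : 2 ≤ d := by
  have h1 := Finset.ne_of_mem_erase hd
  have h2 := Nat.pos_of_mem_divisors (Finset.mem_of_mem_erase hd)
  omega

theorem two_pow_le_prod_of_mem_tuples {r v : ℕ} {d : Fin v → ℕ} (hd : d ∈ tuples q r v) :
    2 ^ v ≤ ∏ i, d i := by
  rw [tuples, Finset.mem_filter, Fintype.mem_piFinset] at hd
  calc 2 ^ v = ∏ _i : Fin v, 2 := by simp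
    _ ≤ _ := Finset.prod_le_prod' fun i _ => two_le_of_mem_erase (hd.1 i)

theorem card_tuples_le (r v : ℕ) : (tuples q r v).card ≤ (expG q).divisors.card ^ v := by
  refine (Finset.card_filter_le _ _).trans ?_
  rw [Fintype.card_piFinset_const]
  exact Nat.pow_le_pow_left (Finset.card_le_card (Finset.erase_subset _ _)) v

/-- Splitting off the last entry is legitimate because entries are at least 1, so the truncated
tuple still satisfies the product bound. -/
theorem sum_tuples_succ {M : Type*} [AddCommMonoid M] (r v : ℕ) (f : (Fin (v + 1) → ℕ) → M) :
    ∑ e ∈ tuples q r (v + 1), f e = ∑ d ∈ tuples q r v, ∑ c ∈ (expG q).divisors.erase 1,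
      if (∏ i, d i) * c ≤ 2 ^ r then f (Fin.snoc d c) else 0 := by
  rw [← Finset.sum_product', ← Finset.sum_filter]
  symm
  refine Finset.sum_bij' (fun x _ => Fin.snoc x.1 x.2) (fun e _ => (Fin.init e, e (Fin.last v)))
    ?_ ?_ ?_ ?_ ?_
  · rintro ⟨d, c⟩ h
    simp only [tuples, Finset.mem_filter, Finset.mem_product, Fintype.mem_piFinset] at h ⊢
    refine ⟨fun i => ?_, ?_⟩
    · refine Fin.lastCases ?_ (fun i => ?_) i
      · simpa using h.1.2
      · simpa using h.1.1.1 i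
    · rw [Fin.prod_univ_castSucc]
      simpa using h.2
  · intro e h
    simp only [tuples, Finset.mem_filter, Finset.mem_product, Fintype.mem_piFinset] at h ⊢
    have hprod : (∏ i, Fin.init e i) * e (Fin.last v) ≤ 2 ^ r := by
      rw [Fin.prod_univ_castSucc] at h
      exact h.2
    have hpos := two_le_of_mem_erase (h.1 (Fin.last v))
    exact ⟨⟨⟨fun i => h.1 _, (Nat.le_mul_of_pos_right _ (by omega)).trans hprod⟩, h.1 _⟩, hprod⟩
  · rintro ⟨d, c⟩ _
    simp
  · intro e _
    simp
  · intro _ _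
    rfl

theorem abs_smul_N_apply_le (c : ℕ) (B₀ B₁ : CyclicSubgroup q) :
    |((c : ℝ)⁻¹ • N q c) B₀ B₁| ≤ (c : ℝ)⁻¹ := by
  rw [Matrix.smul_apply, smul_eq_mul, abs_mul, abs_of_nonneg (by positivity)]
  exact mul_le_of_le_one_right (by positivity) (abs_N_apply_le c B₀ B₁)

variable [NeZero q]

open Classical in
/-- The product `(N_{d₁}/d₁) ⋯ (N_{d_v}/d_v)`. -/
noncomputable def normProd (q : ℕ) [NeZero q] {v : ℕ} (d : Fin v → ℕ) :
    Matrix (CyclicSubgroup q) (CyclicSubgroup q) ℝ :=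
  (List.ofFn fun i : Fin v => ((d i : ℝ)⁻¹) • N q (d i)).prod

theorem normProd_snoc {v : ℕ} (d : Fin v → ℕ) (c : ℕ) :
    normProd q (Fin.snoc d c : Fin (v + 1) → ℕ) = normProd q d * ((c : ℝ)⁻¹ • N q c) := by
  classical
  rw [normProd, List.ofFn_succ', List.concat_eq_append, List.prod_append, List.prod_singleton]
  simp [normProd]

theorem normProd_succ {v : ℕ} (d : Fin (v + 1) → ℕ) :
    normProd q d = ((d 0 : ℝ)⁻¹ • N q (d 0)) * normProd q (Fin.tail d) := by
  classical
  rw [normProd, List.ofFn_succ, List.prod_cons]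
  rfl

theorem abs_mul_apply_le {ι : Type*} [Fintype ι] {A B : Matrix ι ι ℝ} {a b : ℝ}
    (hA : ∀ i j, |A i j| ≤ a) (hB : ∀ i j, |B i j| ≤ b) (i j : ι) :
    |(A * B) i j| ≤ Fintype.card ι * (a * b) := by
  rw [Matrix.mul_apply]
  calc _ ≤ ∑ k, |A i k * B k j| := Finset.abs_sum_le_sum_abs _ _
    _ ≤ ∑ _k : ι, a * b := Finset.sum_le_sum fun k _ => by
        rw [abs_mul]
        exact mul_le_mul (hA i k) (hB k j) (abs_nonneg _) ((abs_nonneg _).trans (hA i k))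
    _ = _ := by simp

/-- Each factor N_d/d has entries at most 1/d in modulus, and each of the v matrix products costs a
factor |𝒢|. -/
theorem abs_normProd_mul_apply_le {v : ℕ} (d : Fin v → ℕ) (c : ℕ) (B₀ B₁ : CyclicSubgroup q) :
    |(normProd q d * ((c : ℝ)⁻¹ • N q c)) B₀ B₁| ≤
      (Fintype.card (CyclicSubgroup q) : ℝ) ^ v * (((∏ i, d i) * c : ℕ) : ℝ)⁻¹ := by
  induction v generalizing B₀ B₁ with
  | zero =>
    classical
    have h1 : normProd q d = 1 := by simp [normProd]
    rw [h1, Matrix.one_mul]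
    simpa using abs_smul_N_apply_le c B₀ B₁
  | succ v ih =>
    rw [normProd_succ, Matrix.mul_assoc]
    refine (abs_mul_apply_le (abs_smul_N_apply_le (d 0)) (ih (Fin.tail d)) B₀ B₁).trans_eq ?_
    rw [Fin.prod_univ_succ, pow_succ]
    push_cast
    simp only [mul_inv, Fin.tail]
    ring

variable (q) in
/-- The vector with entries `classTail P B (t * j)`. -/
noncomputable def tailVec (P : ℝ) (j t : ℕ) : CyclicSubgroup q → ℝ :=
  fun B => classTail P B (t * j)

variable (q) in
/-- The contribution to the iterated recursion of a tuple `d` extended by `c`. -/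
noncomputable def recTerm (P : ℝ) (j : ℕ) {v : ℕ} (d : Fin v → ℕ) (c : ℕ) :
    CyclicSubgroup q → ℝ :=
  (normProd q d * ((c : ℝ)⁻¹ • N q c)).mulVec (tailVec q P j ((∏ i, d i) * c))

variable (q) in
/-- The sum over the admissible tuples of length `v`. -/
noncomputable def levelSum (P : ℝ) (j r v : ℕ) : CyclicSubgroup q → ℝ :=
  ∑ d ∈ tuples q r v, (normProd q d).mulVec (tailVec q P j (∏ i, d i))

theorem levelSum_zero (P : ℝ) (j r : ℕ) : levelSum q P j r 0 = tailVec q P j 1 := by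
  classical
  have h : tuples q r 0 = Finset.univ := by
    ext d
    simp [tuples, Nat.one_le_two_pow]
  rw [levelSum, h]
  simp [normProd]

theorem levelSum_succ (P : ℝ) (j r v : ℕ) : levelSum q P j r (v + 1) =
    ∑ d ∈ tuples q r v, ∑ c ∈ (expG q).divisors.erase 1,
      if (∏ i, d i) * c ≤ 2 ^ r then recTerm q P j d c else 0 := by
  rw [levelSum, sum_tuples_succ]
  simp only [normProd_snoc, Fin.prod_univ_castSucc, Fin.snoc_castSucc, Fin.snoc_last, recTerm]

section Recursion

variable {P : ℝ} (hP : 4 ≤ P) {j : ℕ} (hj : 2 ≤ j)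
include hP hj

theorem M1inv_mulVec_Gam_eq_add {t : ℕ} (ht : 0 < t) :
    (M1inv q).mulVec (Gam P (j : ℝ) t) = tailVec q P j t +
      ∑ c ∈ (expG q).divisors.erase 1, ((c : ℝ)⁻¹ • N q c).mulVec (tailVec q P j (t * c)) := by
  classical
  have h1 : 1 ∈ (expG q).divisors := Nat.one_mem_divisors.2 Monoid.exponent_ne_zero_of_finite
  rw [M1inv_mulVec_Gam hP (by nlinarith : 2 ≤ t * j) rfl, ← Finset.add_sum_erase _ _ h1, N_one]
  simp only [Nat.cast_one, inv_one, one_smul, Matrix.one_mulVec, one_mul, Matrix.smul_mulVec]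
  congr 1
  refine Finset.sum_congr rfl fun c _ => ?_
  congr 2
  funext B
  rw [tailVec, mul_comm t c, mul_assoc]

theorem sum_normProd_mulVec_Gam (r v : ℕ) :
    ∑ d ∈ tuples q r v, (normProd q d * M1inv q).mulVec (Gam P (j : ℝ) (∏ i, d i)) =
      levelSum q P j r v +
        ∑ d ∈ tuples q r v, ∑ c ∈ (expG q).divisors.erase 1, recTerm q P j d c := by
  rw [levelSum, ← Finset.sum_add_distrib]
  refine Finset.sum_congr rfl fun d hd => ?_
  rw [← Matrix.mulVec_mulVec, M1inv_mulVec_Gam_eq_add hP hj (prod_pos_of_mem_tuples hd),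
    Matrix.mulVec_add, Matrix.mulVec_sum]
  simp only [recTerm, Matrix.mulVec_mulVec]

/-- The sum telescopes: extensions of a tuple with product within the bound cancel, by the
alternating sign, against the leading terms of the next level. Only the extensions above the bound
survive, together with all extensions at the last level, which has no successor. -/
theorem approxVec_eq (r : ℕ) : approxVec q P (j : ℝ) (r + 1) =
    tailVec q P j 1 +
      ∑ v ∈ Finset.range r, (-1 : ℝ) ^ v • ∑ d ∈ tuples q (r + 1) v,
        ∑ c ∈ (expG q).divisors.erase 1,
          (if 2 ^ (r + 1) < (∏ i, d i) * c then recTerm q P j d c else 0) +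
      (-1 : ℝ) ^ r • ∑ d ∈ tuples q (r + 1) r, ∑ c ∈ (expG q).divisors.erase 1,
        recTerm q P j d c := by
  have hstep : ∀ s : ℕ, ∑ v ∈ Finset.range s, (-1 : ℝ) ^ v • ∑ d ∈ tuples q (r + 1) v,
      (normProd q d * M1inv q).mulVec (Gam P (j : ℝ) (∏ i, d i)) =
      tailVec q P j 1 + ∑ v ∈ Finset.range s, (-1 : ℝ) ^ v • ∑ d ∈ tuples q (r + 1) v,
        ∑ c ∈ (expG q).divisors.erase 1,
          (if 2 ^ (r + 1) < (∏ i, d i) * c then recTerm q P j d c else 0) -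
        (-1 : ℝ) ^ s • levelSum q P j (r + 1) s := by
    intro s
    induction s with
    | zero => simp [levelSum_zero]
    | succ s ih =>
      rw [Finset.sum_range_succ, ih, Finset.sum_range_succ, sum_normProd_mulVec_Gam hP hj,
        levelSum_succ]
      have hsplit : ∑ d ∈ tuples q (r + 1) s, ∑ c ∈ (expG q).divisors.erase 1, recTerm q P j d c =
          ∑ d ∈ tuples q (r + 1) s, ∑ c ∈ (expG q).divisors.erase 1,
            (if (∏ i, d i) * c ≤ 2 ^ (r + 1) then recTerm q P j d c else 0) +
          ∑ d ∈ tuples q (r + 1) s, ∑ c ∈ (expG q).divisors.erase 1,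
            (if 2 ^ (r + 1) < (∏ i, d i) * c then recTerm q P j d c else 0) := by
        simp only [← Finset.sum_add_distrib]
        refine Finset.sum_congr rfl fun d _ => Finset.sum_congr rfl fun c _ => ?_
        by_cases h : (∏ i, d i) * c ≤ 2 ^ (r + 1)
        · rw [if_pos h, if_neg h.not_gt, add_zero]
        · rw [if_neg h, if_pos (not_le.1 h), zero_add]
      rw [hsplit, pow_succ]
      module
  have h := hstep r
  rw [approxVec, Finset.sum_range_succ]
  change ∑ v ∈ Finset.range r, (-1 : ℝ) ^ v • ∑ d ∈ tuples q (r + 1) v,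
      (normProd q d * M1inv q).mulVec (Gam P (j : ℝ) (∏ i, d i)) +
    (-1 : ℝ) ^ r • ∑ d ∈ tuples q (r + 1) r,
      (normProd q d * M1inv q).mulVec (Gam P (j : ℝ) (∏ i, d i)) = _
  rw [h, sum_normProd_mulVec_Gam hP hj]
  module

theorem abs_recTerm_le {r v : ℕ} {d : Fin v → ℕ} {c : ℕ} (h : 2 ^ r ≤ (∏ i, d i) * c)
    (B : CyclicSubgroup q) : |recTerm q P j d c B| ≤
      (Fintype.card (CyclicSubgroup q) : ℝ) ^ v * (2 ^ r)⁻¹ * primeTail P (2 ^ r * j) *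
        (1 / 16) ^ ((∏ i, d i) * c - 2 ^ r) := by
  obtain ⟨m, hm⟩ := Nat.exists_eq_add_of_le h
  have hr : 1 ≤ 2 ^ r := Nat.one_le_two_pow
  have hu : 2 ≤ 2 ^ r * j := by nlinarith
  have hu' : 2 ≤ (2 ^ r + m) * j := by nlinarith
  have hD : (((∏ i, d i) * c : ℕ) : ℝ)⁻¹ ≤ (2 ^ r)⁻¹ :=
    inv_anti₀ (by positivity) (by exact_mod_cast h)
  have hT : primeTail P ((2 ^ r + m) * j) ≤ (1 / 16) ^ m * primeTail P (2 ^ r * j) := by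
    rw [add_mul]
    refine (primeTail_add_le hP hu (m * j)).trans
      (mul_le_mul_of_nonneg_right ?_ (primeTail_nonneg hP hu))
    rw [div_pow, one_pow]
    refine one_div_le_one_div_of_le (by positivity) ?_
    calc (16 : ℝ) ^ m = 4 ^ (m * 2) := by rw [mul_comm, pow_mul]; norm_num
      _ ≤ 4 ^ (m * j) := pow_le_pow_right₀ (by norm_num) (Nat.mul_le_mul_left m hj)
      _ ≤ P ^ (m * j) := pow_le_pow_left₀ (by norm_num) hP _
  rw [recTerm, Matrix.mulVec, dotProduct]
  calc _ ≤ ∑ B' : CyclicSubgroup q, |(normProd q d * ((c : ℝ)⁻¹ • N q c)) B B' *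
          tailVec q P j ((∏ i, d i) * c) B'| := Finset.abs_sum_le_sum_abs _ _
    _ ≤ ∑ B' : CyclicSubgroup q, (Fintype.card (CyclicSubgroup q) : ℝ) ^ v * (2 ^ r)⁻¹ *
          classTail P B' ((2 ^ r + m) * j) := by
        refine Finset.sum_le_sum fun B' _ => ?_
        have hc := classTail_nonneg hP hu' B'
        rw [abs_mul, tailVec, hm, abs_of_nonneg hc]
        refine mul_le_mul_of_nonneg_right ((abs_normProd_mul_apply_le d c B B').trans ?_) hc
        exact mul_le_mul_of_nonneg_left hD (by positivity)
    _ ≤ (Fintype.card (CyclicSubgroup q) : ℝ) ^ v * (2 ^ r)⁻¹ *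
          ((1 / 16) ^ m * primeTail P (2 ^ r * j)) := by
        rw [← Finset.mul_sum]
        exact mul_le_mul_of_nonneg_left ((sum_classTail_le hP hu').trans hT) (by positivity)
    _ = _ := by rw [hm, Nat.add_sub_cancel_left]; ring

/-- For fixed d, distinct c give distinct excesses of the product over 2^r, so the sum over c is
dominated by a geometric series of sum 16/15. Thus c costs no divisor-count factor, only the v
entries of d do. -/
theorem sum_abs_recTerm_le (r v : ℕ) (B : CyclicSubgroup q) :
    ∑ d ∈ tuples q r v, ∑ c ∈ (expG q).divisors.erase 1,
      (if 2 ^ r ≤ (∏ i, d i) * c then |recTerm q P j d c B| else 0) ≤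
      ((Fintype.card (CyclicSubgroup q) : ℝ) * (expG q).divisors.card) ^ v *
        ((2 ^ r)⁻¹ * primeTail P (2 ^ r * j) * (16 / 15)) := by
  have hr : 1 ≤ 2 ^ r := Nat.one_le_two_pow
  have hT := primeTail_nonneg hP (show 2 ≤ 2 ^ r * j by nlinarith)
  have hgeom : Summable fun m : ℕ => ((1 : ℝ) / 16) ^ m :=
    summable_geometric_of_lt_one (by norm_num) (by norm_num)
  have hgeom' : ∑' m : ℕ, ((1 : ℝ) / 16) ^ m = 16 / 15 := by
    rw [tsum_geometric_of_lt_one (by norm_num) (by norm_num)]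
    norm_num
  set A := (Fintype.card (CyclicSubgroup q) : ℝ) ^ v * (2 ^ r)⁻¹ * primeTail P (2 ^ r * j)
  have hA : 0 ≤ A := by positivity
  have hinner : ∀ d ∈ tuples q r v, ∑ c ∈ (expG q).divisors.erase 1,
      (if 2 ^ r ≤ (∏ i, d i) * c then |recTerm q P j d c B| else 0) ≤ A * (16 / 15) := by
    intro d hd
    rw [← Finset.sum_filter]
    have hpos := prod_pos_of_mem_tuples hd
    calc _ ≤ ∑ c ∈ ((expG q).divisors.erase 1).filter fun c => 2 ^ r ≤ (∏ i, d i) * c,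
            A * (1 / 16) ^ ((∏ i, d i) * c - 2 ^ r) := Finset.sum_le_sum fun c hc =>
          abs_recTerm_le hP hj (Finset.mem_filter.1 hc).2 B
      _ = A * ∑ m ∈ (((expG q).divisors.erase 1).filter fun c => 2 ^ r ≤ (∏ i, d i) * c).image
            fun c => (∏ i, d i) * c - 2 ^ r, (1 / 16) ^ m := by
          rw [← Finset.mul_sum, Finset.sum_image]
          intro c hc c' hc' h
          have h1 := (Finset.mem_filter.1 hc).2
          have h2 := (Finset.mem_filter.1 hc').2
          dsimp only at h
          exact Nat.eq_of_mul_eq_mul_left hpos (by omega)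
      _ ≤ A * (16 / 15) := by
          rw [← hgeom']
          exact mul_le_mul_of_nonneg_left
            (hgeom.sum_le_tsum _ fun m _ => by positivity) hA
  have hcard : ((tuples q r v).card : ℝ) ≤ ((expG q).divisors.card : ℝ) ^ v := by
    exact_mod_cast card_tuples_le r v
  calc _ ≤ ∑ _d ∈ tuples q r v, A * (16 / 15) := Finset.sum_le_sum hinner
    _ = (tuples q r v).card * (A * (16 / 15)) := by rw [Finset.sum_const, nsmul_eq_mul]
    _ ≤ ((expG q).divisors.card : ℝ) ^ v * (A * (16 / 15)) :=
        mul_le_mul_of_nonneg_right hcard (by positivity)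
    _ = _ := by rw [mul_pow]; ring

theorem abs_approxVec_sub_le (r : ℕ) (B : CyclicSubgroup q) :
    |approxVec q P (j : ℝ) (r + 1) B - classTail P B j| ≤ (r + 1) *
      (((Fintype.card (CyclicSubgroup q) : ℝ) * (expG q).divisors.card / 2) ^ r *
        (8 / 15 * primeTail P (2 ^ (r + 1) * j))) := by
  set X := (Fintype.card (CyclicSubgroup q) : ℝ) * (expG q).divisors.card with hX
  have hr : 1 ≤ 2 ^ (r + 1) := Nat.one_le_two_pow
  have hT := primeTail_nonneg hP (show 2 ≤ 2 ^ (r + 1) * j by nlinarith)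
  set Y := (2 ^ (r + 1))⁻¹ * primeTail P (2 ^ (r + 1) * j) * (16 / 15) with hY
  have hY0 : 0 ≤ Y := by positivity
  have hX1 : 1 ≤ X := by
    have h1 : 0 < Fintype.card (CyclicSubgroup q) := Fintype.card_pos_iff.2 ⟨B⟩
    have h2 : 0 < (expG q).divisors.card := Finset.card_pos.2
      ⟨1, Nat.one_mem_divisors.2 Monoid.exponent_ne_zero_of_finite⟩
    rw [hX]
    exact_mod_cast Nat.mul_pos h1 h2
  have hlevel : ∀ v ≤ r, ∀ f : (Fin v → ℕ) → ℕ → ℝ,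
      (∀ d ∈ tuples q (r + 1) v, ∀ c ∈ (expG q).divisors.erase 1,
        |f d c| ≤ if 2 ^ (r + 1) ≤ (∏ i, d i) * c then |recTerm q P j d c B| else 0) →
      |(-1 : ℝ) ^ v * ∑ d ∈ tuples q (r + 1) v, ∑ c ∈ (expG q).divisors.erase 1, f d c| ≤
        X ^ r * Y := by
    intro v hv f hf
    rw [abs_mul, abs_pow, abs_neg, abs_one, one_pow, one_mul]
    calc _ ≤ ∑ d ∈ tuples q (r + 1) v, |∑ c ∈ (expG q).divisors.erase 1, f d c| :=
          Finset.abs_sum_le_sum_abs _ _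
      _ ≤ ∑ d ∈ tuples q (r + 1) v, ∑ c ∈ (expG q).divisors.erase 1, |f d c| :=
          Finset.sum_le_sum fun d _ => Finset.abs_sum_le_sum_abs _ _
      _ ≤ _ := Finset.sum_le_sum fun d hd => Finset.sum_le_sum fun c hc => hf d hd c hc
      _ ≤ X ^ v * Y := sum_abs_recTerm_le hP hj (r + 1) v B
      _ ≤ X ^ r * Y := mul_le_mul_of_nonneg_right (pow_le_pow_right₀ hX1 hv) hY0
  have heq : approxVec q P (j : ℝ) (r + 1) B - classTail P B j =
      ∑ v ∈ Finset.range r, (-1 : ℝ) ^ v * ∑ d ∈ tuples q (r + 1) v,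
        ∑ c ∈ (expG q).divisors.erase 1,
          (if 2 ^ (r + 1) < (∏ i, d i) * c then recTerm q P j d c B else 0) +
      (-1 : ℝ) ^ r * ∑ d ∈ tuples q (r + 1) r, ∑ c ∈ (expG q).divisors.erase 1,
        recTerm q P j d c B := by
    rw [approxVec_eq hP hj]
    simp only [Pi.add_apply, Finset.sum_apply, Pi.smul_apply, smul_eq_mul, apply_ite
      (fun f : CyclicSubgroup q → ℝ => f B), Pi.zero_apply, tailVec, one_mul]
    ring
  rw [heq]
  calc _ ≤ ∑ _v ∈ Finset.range r, X ^ r * Y + X ^ r * Y := by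
        refine (abs_add_le _ _).trans (add_le_add ((Finset.abs_sum_le_sum_abs _ _).trans
          (Finset.sum_le_sum fun v hv => ?_)) ?_)
        · refine hlevel v (Finset.mem_range.1 hv).le _ fun d _ c _ => ?_
          by_cases h : 2 ^ (r + 1) < (∏ i, d i) * c
          · rw [if_pos h, if_pos h.le]
          · rw [if_neg h, abs_zero]
            split_ifs <;> positivity
        · refine hlevel r le_rfl _ fun d hd c hc => ?_
          -- At the last level there are r + 1 factors, all at least 2, so every product reaches
          -- 2^(r+1).
          rw [if_pos]
          rw [pow_succ]
          exact Nat.mul_le_mul (two_pow_le_prod_of_mem_tuples hd) (two_le_of_mem_erase hc)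
    _ = _ := by
        -- Of the factor 2^(-(r+1)), the part 2^(-r) goes into (X/2)^r; the remaining 1/2 turns
        -- 16/15 into 8/15.
        rw [Finset.sum_const, Finset.card_range, nsmul_eq_mul, hY, div_pow, pow_succ]
        field_simp
        ring

end Recursion

end EulerProd

namespace EulerProd

/-! ### Möbius transform and expansion in -log(1 - x^j) -/

section Witt

/-- `(1/k) ∑_{d ∣ k} μ(k/d) s(d)`. -/
noncomputable def wittTransform (s : ℕ → ℝ) (k : ℕ) : ℝ :=
  1 / (k : ℝ) * ∑ d ∈ k.divisors, (ArithmeticFunction.moebius (k / d) : ℝ) * s d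

theorem sum_divisors_mul_wittTransform (s : ℕ → ℝ) {k : ℕ} (hk : 0 < k) :
    ∑ d ∈ k.divisors, (d : ℝ) * wittTransform s d = s k := by
  have h : ∀ n > 0, ∑ x ∈ n.divisorsAntidiagonal,
      (ArithmeticFunction.moebius x.1 : ℝ) * s x.2 = n * wittTransform s n := by
    intro n hn
    have : (n : ℝ) ≠ 0 := by positivity
    rw [wittTransform, ← mul_assoc, mul_one_div_cancel this, one_mul,
      Nat.sum_divisorsAntidiagonal' fun i j => (ArithmeticFunction.moebius i : ℝ) * s j]
  exact ArithmeticFunction.sum_eq_iff_sum_mul_moebius_eq.2 h k hk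

theorem sum_divisors_pow_le {β : ℝ} (hβ : 2 ≤ β) (k : ℕ) :
    ∑ d ∈ k.divisors, β ^ d ≤ 2 * β ^ k := by
  have h1 : ∑ d ∈ k.divisors, β ^ d ≤ ∑ d ∈ Finset.range (k + 1), β ^ d :=
    Finset.sum_le_sum_of_subset_of_nonneg (fun d hd => Finset.mem_range.2
      (Nat.lt_succ_of_le (Nat.divisor_le hd))) fun d _ _ => by positivity
  have h2 : ∀ k : ℕ, ∑ d ∈ Finset.range (k + 1), β ^ d ≤ 2 * β ^ k := by
    intro k
    induction k with
    | zero => norm_num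
    | succ k ih =>
      rw [Finset.sum_range_succ]
      have : 0 < β ^ k := by positivity
      rw [pow_succ]
      nlinarith
  exact h1.trans (h2 k)

variable {s : ℕ → ℝ} {C β : ℝ} (hC : 0 ≤ C) (hβ : 2 ≤ β) (hs : ∀ k, |s k| ≤ C * β ^ k)
include hC hβ hs

theorem abs_wittTransform_le (k : ℕ) : |wittTransform s k| ≤ 2 * C * β ^ k / k := by
  have h : |∑ d ∈ k.divisors, (ArithmeticFunction.moebius (k / d) : ℝ) * s d| ≤
      C * (2 * β ^ k) := by
    refine (Finset.abs_sum_le_sum_abs _ _).trans ?_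
    refine le_trans ?_ (mul_le_mul_of_nonneg_left (sum_divisors_pow_le hβ k) hC)
    rw [Finset.mul_sum]
    refine Finset.sum_le_sum fun d _ => ?_
    rw [abs_mul]
    refine (mul_le_of_le_one_left (abs_nonneg _) ?_).trans (hs d)
    exact_mod_cast ArithmeticFunction.abs_moebius_le_one
  rw [wittTransform, abs_mul, abs_of_nonneg (by positivity), one_div_mul_eq_div]
  refine div_le_div_of_nonneg_right (h.trans_eq (by ring)) (by positivity)

/-- The general estimate only gives the constant 1 at k = 2, too weak for the final constant. There
(s(2) - s(1))/2 is bounded directly, using β ≤ β²/2; for k ≥ 3, 2/k ≤ 3/4. -/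
theorem abs_wittTransform_le_of_two_le {k : ℕ} (hk : 2 ≤ k) :
    |wittTransform s k| ≤ 3 / 4 * C * β ^ k := by
  obtain rfl | hk := hk.eq_or_lt
  · have h1 : wittTransform s 2 = 1 / 2 * (s 2 - s 1) := by
      rw [wittTransform, Nat.Prime.divisors Nat.prime_two, Finset.sum_pair (by norm_num)]
      simp [ArithmeticFunction.moebius_apply_prime Nat.prime_two]
      ring
    rw [h1, abs_mul, abs_of_pos (by norm_num : (0 : ℝ) < 1 / 2)]
    have h2 := abs_sub (s 2) (s 1)
    have h3 := hs 1
    have h4 := hs 2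
    have h5 : C * β ^ 1 * 2 ≤ C * β ^ 2 := by
      nlinarith [mul_nonneg (mul_nonneg hC (by linarith : 0 ≤ β)) (sub_nonneg.2 hβ)]
    linarith
  · refine (abs_wittTransform_le hC hβ hs k).trans ?_
    have hk' : (3 : ℝ) ≤ k := by exact_mod_cast hk
    rw [div_le_iff₀ (by linarith)]
    have : 0 ≤ C * β ^ k := by positivity
    nlinarith

theorem summable_wittTransform_mul {x : ℝ} (hx : 0 ≤ x) (hβx : β * x ≤ 1 / 2) :
    Summable fun p : ℕ+ × ℕ+ =>
      wittTransform s p.1 * ((x ^ (p.1 : ℕ)) ^ (p.2 : ℕ) / (p.2 : ℕ)) := by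
  have hx4 : x ≤ 1 / 4 := by nlinarith
  have hg1 : Summable fun j : ℕ+ => 2 * C * (1 / 2 : ℝ) ^ (j : ℕ) :=
    ((summable_geometric_of_lt_one (by norm_num) (by norm_num)).comp_injective
      PNat.coe_injective).mul_left _
  have hg2 : Summable fun m : ℕ+ => 4 * (1 / 4 : ℝ) ^ (m : ℕ) :=
    ((summable_geometric_of_lt_one (by norm_num) (by norm_num)).comp_injective
      PNat.coe_injective).mul_left _
  refine .of_norm_bounded (hg1.mul_of_nonneg hg2 (fun j => by positivity)
    fun m => by positivity) ?_
  rintro ⟨j, m⟩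
  obtain ⟨n, hn⟩ := Nat.exists_eq_add_of_le m.2
  have hm : (m : ℕ) = n + 1 := by rw [add_comm]; exact hn
  have hm1 : (1 : ℝ) ≤ (m : ℕ) := by exact_mod_cast m.2
  have hj1 : (1 : ℝ) ≤ (j : ℕ) := by exact_mod_cast j.2
  have hb : |wittTransform s j| ≤ 2 * C * β ^ (j : ℕ) :=
    (abs_wittTransform_le hC hβ hs j).trans (div_le_self (by positivity) hj1)
  have hxj : x ^ (j : ℕ) ≤ 1 / 4 := (pow_le_of_le_one hx (by linarith) j.2.ne').trans hx4
  have hbx : β ^ (j : ℕ) * x ^ (j : ℕ) ≤ (1 / 2) ^ (j : ℕ) := by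
    rw [← mul_pow]
    exact pow_le_pow_left₀ (by positivity) hβx _
  rw [Real.norm_eq_abs, abs_mul, abs_of_nonneg (by positivity : 0 ≤ (x ^ (j : ℕ)) ^ (m : ℕ) / _)]
  calc _ ≤ 2 * C * β ^ (j : ℕ) * (x ^ (j : ℕ)) ^ (m : ℕ) :=
        mul_le_mul hb (div_le_self (by positivity) hm1) (by positivity) (by positivity)
    _ = 2 * C * (β ^ (j : ℕ) * x ^ (j : ℕ)) * (x ^ (j : ℕ)) ^ n := by rw [hm, pow_succ]; ring
    _ ≤ 2 * C * (1 / 2) ^ (j : ℕ) * (1 / 4) ^ n := by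
        have := pow_le_pow_left₀ (by positivity) hxj n
        gcongr
    _ = _ := by rw [hm, pow_succ]; ring

/-- Consider the double series of b(j) x^(jm)/m, with b the transform of s. Summing over m gives the
logarithms; grouping by k = jm gives x^k/k times Σ_{j ∣ k} j b(j) = s(k). -/
theorem hasSum_wittTransform_mul_neg_log {x L : ℝ} (hx : 0 ≤ x) (hβx : β * x ≤ 1 / 2)
    (hL : HasSum (fun k : ℕ => s k * x ^ k / k) L) :
    HasSum (fun j : ℕ => wittTransform s j * -Real.log (1 - x ^ j)) L := by
  have hx1 : x < 1 := by nlinarith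
  have hsum := summable_wittTransform_mul hC hβ hs hx hβx
  have hrange : ∀ k : ℕ, k ∉ Set.range ((↑) : ℕ+ → ℕ) → k = 0 := fun k hk => by
    by_contra h0
    exact hk ⟨⟨k, Nat.pos_of_ne_zero h0⟩, rfl⟩
  -- The index 0 contributes nothing on either side, by the convention of division by zero.
  rw [← PNat.coe_injective.hasSum_iff] at hL ⊢
  · have hrow : ∀ j : ℕ+, HasSum (fun m : ℕ+ =>
        wittTransform s j * ((x ^ (j : ℕ)) ^ (m : ℕ) / (m : ℕ)))
        (wittTransform s j * -Real.log (1 - x ^ (j : ℕ))) := by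
      intro j
      have hxj : |x ^ (j : ℕ)| < 1 := by
        rw [abs_of_nonneg (by positivity)]
        exact pow_lt_one₀ hx hx1 j.2.ne'
      have h := Real.hasSum_pow_div_log_of_abs_lt_one hxj
      rw [← Equiv.pnatEquivNat.hasSum_iff] at h
      have hfun : ((fun n : ℕ => (x ^ (j : ℕ)) ^ (n + 1) / ((n : ℝ) + 1)) ∘ Equiv.pnatEquivNat) =
          fun m : ℕ+ => (x ^ (j : ℕ)) ^ (m : ℕ) / (m : ℕ) := by
        funext m
        have hm : m.natPred + 1 = (m : ℕ) := m.natPred_add_one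
        simp only [Function.comp_apply, Equiv.pnatEquivNat_apply, ← hm]
        push_cast
        rfl
      rw [hfun] at h
      exact h.mul_left _
    have hsig : HasSum (fun p : ℕ+ × ℕ+ =>
        wittTransform s p.1 * ((x ^ (p.1 : ℕ)) ^ (p.2 : ℕ) / (p.2 : ℕ))) L := by
      have h2 := (sigmaAntidiagonalEquivProd.summable_iff.2 hsum)
      have h3 : HasSum (fun k : ℕ+ => s k * x ^ (k : ℕ) / (k : ℕ))
          (∑' c, ((fun p : ℕ+ × ℕ+ => wittTransform s p.1 *
            ((x ^ (p.1 : ℕ)) ^ (p.2 : ℕ) / (p.2 : ℕ))) ∘ sigmaAntidiagonalEquivProd) c) := by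
        refine h2.hasSum.sigma fun k => ?_
        have h4 := hasSum_fintype fun c : (k : ℕ).divisorsAntidiagonal =>
          ((fun p : ℕ+ × ℕ+ => wittTransform s p.1 *
            ((x ^ (p.1 : ℕ)) ^ (p.2 : ℕ) / (p.2 : ℕ))) ∘ sigmaAntidiagonalEquivProd) ⟨k, c⟩
        convert h4 using 1
        have hterm : ∀ c : (k : ℕ).divisorsAntidiagonal,
            ((fun p : ℕ+ × ℕ+ => wittTransform s p.1 *
              ((x ^ (p.1 : ℕ)) ^ (p.2 : ℕ) / (p.2 : ℕ))) ∘ sigmaAntidiagonalEquivProd) ⟨k, c⟩ =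
            x ^ (k : ℕ) / (k : ℕ) * (c.1.1 * wittTransform s c.1.1) := by
          rintro ⟨⟨a, b⟩, hc⟩
          have hab := (Nat.mem_divisorsAntidiagonal.1 hc).1
          have hk0 := (Nat.mem_divisorsAntidiagonal.1 hc).2
          dsimp only at hab
          have ha : (a : ℝ) ≠ 0 := Nat.cast_ne_zero.2 fun h => hk0 (by rw [← hab, h, zero_mul])
          have hb : (b : ℝ) ≠ 0 := Nat.cast_ne_zero.2 fun h => hk0 (by rw [← hab, h, mul_zero])
          simp only [Function.comp_apply, sigmaAntidiagonalEquivProd, Equiv.coe_fn_mk,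
            divisorsAntidiagonalFactors, PNat.mk_coe]
          rw [← pow_mul, hab, ← hab]
          push_cast
          field_simp
        rw [Finset.sum_congr rfl fun c _ => hterm c, ← Finset.mul_sum,
          Finset.sum_coe_sort (k : ℕ).divisorsAntidiagonal
            fun c : ℕ × ℕ => (c.1 : ℝ) * wittTransform s c.1,
          Nat.sum_divisorsAntidiagonal fun a _ => (a : ℝ) * wittTransform s a,
          sum_divisors_mul_wittTransform s k.pos]
        ring
      rw [hL.unique h3]
      exact sigmaAntidiagonalEquivProd.hasSum_iff.1 h2.hasSum
    exact hsig.prod_fiberwise hrow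
  · intro k hk
    simp [hrange k hk]
  · intro k hk
    simp [hrange k hk]

end Witt

/-! ### Power sums of inverse roots -/

section PowerSum

open Polynomial

/-- Taking real parts replaces log by the logarithm of the modulus, which is additive over products
without any choice of branch. -/
theorem hasSum_log_norm_prod (S : Multiset ℂ) {x : ℝ} (hx : 0 ≤ x)
    (hS : ∀ α ∈ S, ‖α‖ * x < 1) :
    HasSum (fun k : ℕ => (S.map fun α => α ^ k).sum.re * x ^ k / k)
      (-Real.log ‖(S.map fun α => 1 - α * (x : ℂ)).prod‖) := by
  induction S using Multiset.induction with
  | empty => simp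
  | cons a S ih =>
    have ih' := ih fun α hα => hS α (Multiset.mem_cons_of_mem hα)
    have hne : ∀ α ∈ a ::ₘ S, 1 - α * (x : ℂ) ≠ 0 := by
      intro α hα h0
      have := hS α hα
      rw [← Real.norm_of_nonneg hx, ← Complex.norm_real, ← norm_mul, ← sub_eq_zero.1 h0] at this
      simp at this
    have ha : ‖a * (x : ℂ)‖ < 1 := by
      rw [norm_mul, Complex.norm_real, Real.norm_of_nonneg hx]
      exact hS a (Multiset.mem_cons_self a S)
    have h1 := Complex.hasSum_re (Complex.hasSum_taylorSeries_neg_log ha)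
    have hprod : (S.map fun α => 1 - α * (x : ℂ)).prod ≠ 0 := by
      rw [Ne, Multiset.prod_eq_zero_iff]
      simp only [Multiset.mem_map, not_exists, not_and]
      exact fun α hα => hne α (Multiset.mem_cons_of_mem hα)
    convert h1.add ih' using 1
    · funext k
      rw [Multiset.map_cons, Multiset.sum_cons, Complex.add_re, add_mul, add_div, mul_pow,
        ← Complex.ofReal_pow, ← Complex.ofReal_natCast,
        Complex.div_ofReal_re, Complex.re_mul_ofReal]
    · rw [Multiset.map_cons, Multiset.prod_cons, norm_mul, Real.log_mul
        (norm_ne_zero_iff.2 (hne a (Multiset.mem_cons_self a S))) (norm_ne_zero_iff.2 hprod),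
        Complex.neg_re, Complex.log_re]
      ring

variable {F : ℝ[X]} (hF0 : F.eval 0 = 1)

include hF0

theorem ne_zero_of_mem_aroots {ρ : ℂ} (hρ : ρ ∈ F.aroots ℂ) : ρ ≠ 0 := by
  rintro rfl
  have h := (mem_aroots.1 hρ).2
  rw [← map_zero (algebraMap ℝ ℂ), aeval_algebraMap_apply_eq_algebraMap_eval, hF0] at h
  simp at h

theorem eval_map_eq_prod (z : ℂ) :
    (F.map (algebraMap ℝ ℂ)).eval z = ((F.aroots ℂ).map fun ρ => 1 - ρ⁻¹ * z).prod := by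
  have hsplit := (IsAlgClosed.splits (F.map (algebraMap ℝ ℂ))).eq_prod_roots
  have heval : ∀ w : ℂ, (F.map (algebraMap ℝ ℂ)).eval w =
      (F.map (algebraMap ℝ ℂ)).leadingCoeff * ((F.aroots ℂ).map fun ρ => w - ρ).prod := by
    intro w
    conv_lhs => rw [hsplit]
    rw [eval_mul, eval_C, eval_multiset_prod, Multiset.map_map]
    simp [aroots_def]
  have h0 : (F.map (algebraMap ℝ ℂ)).eval 0 = 1 := by
    rw [← map_zero (algebraMap ℝ ℂ), eval_map_algebraMap,
      aeval_algebraMap_apply_eq_algebraMap_eval, hF0, map_one]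
  have hfac : ((F.aroots ℂ).map fun ρ => z - ρ).prod =
      ((F.aroots ℂ).map fun ρ => 0 - ρ).prod *
        ((F.aroots ℂ).map fun ρ => 1 - ρ⁻¹ * z).prod := by
    rw [← Multiset.prod_map_mul]
    congr 1
    refine Multiset.map_congr rfl fun ρ hρ => ?_
    have := ne_zero_of_mem_aroots hF0 hρ
    field_simp
    ring
  rw [heval, hfac, ← mul_assoc, ← heval, h0, one_mul]

variable {β : ℝ} (hβ : 2 ≤ β) (hβF : ∀ ρ ∈ F.aroots ℂ, ‖ρ⁻¹‖ ≤ β)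
include hβ hβF

omit hF0 in
theorem abs_powerSum_le (k : ℕ) : |powerSum F k| ≤ F.natDegree * β ^ k := by
  have h : ‖((F.aroots ℂ).map fun ρ => ρ⁻¹ ^ k).sum‖ ≤
      (((F.aroots ℂ).map fun ρ => ρ⁻¹ ^ k).map fun z => ‖z‖).sum :=
    Multiset.le_sum_of_subadditive _ norm_zero.le norm_add_le _
  refine (Complex.abs_re_le_norm _).trans (h.trans ?_)
  have h2 := Multiset.sum_le_card_nsmul
    (((F.aroots ℂ).map fun ρ => ρ⁻¹ ^ k).map fun z => ‖z‖) (β ^ k) (by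
      simp only [Multiset.mem_map, exists_exists_and_eq_and, forall_exists_index, and_imp]
      rintro y ρ hρ rfl
      rw [norm_pow]
      exact pow_le_pow_left₀ (norm_nonneg _) (hβF ρ hρ) k)
  refine h2.trans ?_
  rw [Multiset.card_map, Multiset.card_map, nsmul_eq_mul]
  refine mul_le_mul_of_nonneg_right ?_ (by positivity)
  rw [aroots_def, ← natDegree_map (algebraMap ℝ ℂ)]
  exact_mod_cast card_roots' _

/-- A non-positive value would give a root in (0, x], whose inverse is at least 2β. -/
theorem eval_pos {x : ℝ} (hx : 0 ≤ x) (hβx : β * x ≤ 1 / 2) : 0 < F.eval x := by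
  by_contra! hneg
  obtain ⟨c, hc, hc0⟩ := intermediate_value_Icc' hx F.continuous.continuousOn
    (show (0 : ℝ) ∈ Set.Icc (F.eval x) (F.eval 0) from ⟨hneg, by rw [hF0]; norm_num⟩)
  dsimp only at hc0
  have hFne : F ≠ 0 := by
    rintro rfl
    simp at hF0
  have hroot : (c : ℂ) ∈ F.aroots ℂ := by
    rw [mem_aroots]
    refine ⟨hFne, ?_⟩
    have := aeval_algebraMap_apply_eq_algebraMap_eval (A := ℂ) c F
    rw [hc0, map_zero] at this
    exact this
  have hcpos : 0 < c := lt_of_le_of_ne hc.1 fun h => by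
    rw [← h, hF0] at hc0
    exact one_ne_zero hc0
  have h := hβF _ hroot
  rw [norm_inv, Complex.norm_real, Real.norm_of_nonneg hcpos.le, inv_le_iff_one_le_mul₀ hcpos] at h
  nlinarith [hc.2]

omit hβ in
theorem hasSum_powerSum {x : ℝ} (hx : 0 ≤ x) (hβx : β * x ≤ 1 / 2) :
    HasSum (fun k : ℕ => powerSum F k * x ^ k / k) (-Real.log (F.eval x)) := by
  have h := hasSum_log_norm_prod ((F.aroots ℂ).map fun ρ => ρ⁻¹) hx (by
    simp only [Multiset.mem_map, forall_exists_index, and_imp]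
    rintro α ρ hρ rfl
    nlinarith [hβF ρ hρ])
  simp only [Multiset.map_map, Function.comp_def] at h
  rw [← eval_map_eq_prod hF0] at h
  have hev : (F.map (algebraMap ℝ ℂ)).eval (x : ℂ) = ((F.eval x : ℝ) : ℂ) := by
    rw [eval_map_algebraMap]
    exact aeval_algebraMap_apply_eq_algebraMap_eval (A := ℂ) x F
  rw [hev, Complex.norm_real, Real.norm_eq_abs, Real.log_abs] at h
  exact h

omit hβ hβF in
-- Logarithmic derivative of F at 0.
theorem powerSum_one : powerSum F 1 = -F.coeff 1 := by
  have h0 : (F.map (algebraMap ℝ ℂ)).eval 0 = 1 := by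
    rw [← map_zero (algebraMap ℝ ℂ), eval_map_algebraMap,
      aeval_algebraMap_apply_eq_algebraMap_eval, hF0, map_one]
  have h := (IsAlgClosed.splits (F.map (algebraMap ℝ ℂ))).eval_derivative_div_eval_of_ne_zero
    (x := 0) (by rw [h0]; exact one_ne_zero)
  rw [h0, div_one, ← coeff_zero_eq_eval_zero, coeff_derivative, coeff_map] at h
  have h2 : ((F.aroots ℂ).map fun ρ => ρ⁻¹ ^ 1).sum = -((F.coeff 1 : ℝ) : ℂ) := by
    have h3 : ((F.aroots ℂ).map fun ρ => 1 / (0 - ρ)).sum = ((F.coeff 1 : ℝ) : ℂ) := by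
      rw [aroots_def, ← h]
      simp
    rw [← h3, ← Multiset.sum_map_neg', Multiset.map_map]
    refine congrArg Multiset.sum (Multiset.map_congr rfl fun ρ _ => ?_)
    rw [Function.comp_apply, pow_one, zero_sub, one_div, inv_neg, neg_neg]
  rw [powerSum, h2]
  simp

end PowerSum

/-! ### Exponents attached to F/G -/

section Quotient

open Polynomial

variable {F G : ℝ[X]}

theorem wittExp_sub_eq (F G : ℝ[X]) (k : ℕ) :
    wittExp G k - wittExp F k = wittTransform (fun k => powerSum G k - powerSum F k) k := by
  simp only [wittExp, wittTransform, mul_sub, Finset.sum_sub_distrib]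

theorem wittExp_one (F : ℝ[X]) : wittExp F 1 = powerSum F 1 := by
  simp [wittExp]

theorem wittExp_zero (F : ℝ[X]) : wittExp F 0 = 0 := by
  simp [wittExp]

/-- Equal linear coefficients remove j = 1, where the sum over primes would not be absolutely
controlled. -/
theorem wittExp_one_eq (hF0 : F.eval 0 = 1) (hG0 : G.eval 0 = 1) (hX : X ^ 2 ∣ F - G) :
    wittExp G 1 = wittExp F 1 := by
  have h := X_pow_dvd_iff.1 hX 1 (by norm_num)
  rw [coeff_sub, sub_eq_zero] at h
  rw [wittExp_one, wittExp_one, powerSum_one hF0, powerSum_one hG0, h]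

variable {β : ℝ} (hβ : 2 ≤ β) (hβF : ∀ ρ ∈ F.aroots ℂ, ‖ρ⁻¹‖ ≤ β)
  (hβG : ∀ ρ ∈ G.aroots ℂ, ‖ρ⁻¹‖ ≤ β)
include hβ hβF hβG

theorem abs_powerSum_sub_le (k : ℕ) : |powerSum G k - powerSum F k| ≤
    2 * (max F.natDegree G.natDegree : ℝ) * β ^ k := by
  have hF := abs_powerSum_le hβ hβF k
  have hG := abs_powerSum_le hβ hβG k
  have h1 : (F.natDegree : ℝ) * β ^ k ≤ max (F.natDegree : ℝ) G.natDegree * β ^ k :=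
    mul_le_mul_of_nonneg_right (le_max_left _ _) (by positivity)
  have h2 : (G.natDegree : ℝ) * β ^ k ≤ max (F.natDegree : ℝ) G.natDegree * β ^ k :=
    mul_le_mul_of_nonneg_right (le_max_right _ _) (by positivity)
  have h3 := abs_sub (powerSum G k) (powerSum F k)
  linarith

theorem abs_wittExp_sub_le (k : ℕ) : |wittExp G k - wittExp F k| ≤
    4 * (max F.natDegree G.natDegree : ℝ) * β ^ k / k := by
  rw [wittExp_sub_eq]
  refine (abs_wittTransform_le (by positivity) hβ
    (abs_powerSum_sub_le hβ hβF hβG) k).trans_eq ?_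
  ring

theorem abs_wittExp_sub_le_of_two_le {k : ℕ} (hk : 2 ≤ k) : |wittExp G k - wittExp F k| ≤
    3 / 2 * (max F.natDegree G.natDegree : ℝ) * β ^ k := by
  rw [wittExp_sub_eq]
  refine (abs_wittTransform_le_of_two_le (by positivity) hβ
    (abs_powerSum_sub_le hβ hβF hβG) hk).trans_eq ?_
  ring

theorem hasSum_wittExp_sub (hF0 : F.eval 0 = 1) (hG0 : G.eval 0 = 1) {x : ℝ} (hx : 0 ≤ x)
    (hβx : β * x ≤ 1 / 2) :
    HasSum (fun j : ℕ => (wittExp G j - wittExp F j) * -Real.log (1 - x ^ j))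
      (Real.log (F.eval x / G.eval x)) := by
  simp only [wittExp_sub_eq]
  refine hasSum_wittTransform_mul_neg_log
    (C := 2 * (max F.natDegree G.natDegree : ℝ)) (by positivity) hβ
    (abs_powerSum_sub_le hβ hβF hβG) hx hβx ?_
  have h := (hasSum_powerSum hG0 hβG hx hβx).sub (hasSum_powerSum hF0 hβF hx hβx)
  rw [neg_sub_neg, ← Real.log_div (eval_pos hF0 hβ hβF hx hβx).ne'
    (eval_pos hG0 hβ hβG hx hβx).ne'] at h
  simpa only [sub_mul, sub_div] using h

end Quotient

end EulerProd

/-! ### The Euler product as a series over j, and the error bounds -/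

namespace EulerProd

variable {q : ℕ}

theorem LatticeClass.exists_eq_generators (A : LatticeClass q) : A.1 = generators A.span.1 := by
  obtain ⟨K, hK, hA⟩ := A.2
  have hspan : A.span.1 = K := by
    rw [LatticeClass.span]
    simp only [hA, closure_generators K hK]
  rw [hspan, hA]

theorem card_latticeClass [NeZero q] :
    Nat.card (LatticeClass q) = Fintype.card (CyclicSubgroup q) := by
  rw [← Nat.card_eq_fintype_card]
  exact Nat.card_congr
    { toFun := LatticeClass.span
      invFun := fun K => ⟨generators K.1, K.1, K.2, rfl⟩
      left_inv := fun A => Subtype.ext A.exists_eq_generators.symm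
      right_inv := fun K => Subtype.ext (closure_generators K.1 K.2) }

open Polynomial

section Series

variable {F G : ℝ[X]} {β P : ℝ} (hβ : 2 ≤ β) (hP : 2 * β ≤ P)
include hβ hP

theorem mul_inv_prime_le (p : LargePrime P) : β * (1 / (p.1 : ℝ)) ≤ 1 / 2 := by
  have h := p.2.2
  rw [mul_one_div, div_le_div_iff₀ (by linarith) (by norm_num)]
  linarith

variable (hF0 : F.eval 0 = 1) (hG0 : G.eval 0 = 1) (hX : X ^ 2 ∣ F - G)
  (hβF : ∀ ρ ∈ F.aroots ℂ, ‖ρ⁻¹‖ ≤ β) (hβG : ∀ ρ ∈ G.aroots ℂ, ‖ρ⁻¹‖ ≤ β)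
include hF0 hG0 hX hβF hβG

open Classical in
theorem summable_wittExp_sub_mul (B : CyclicSubgroup q) :
    Summable fun x : LargePrime P × ℕ => (wittExp G x.2 - wittExp F x.2) *
      (if IsGenerator x.1.1 B then -Real.log (1 - 1 / (x.1.1 : ℝ) ^ x.2) else 0) := by
  have hP4 : 4 ≤ P := by linarith
  set M := max (F.natDegree : ℝ) G.natDegree
  -- Here 32/5 = 4 · 3/2 · 16/15: exponent bound, logarithm bound, and 4 to rewrite (1/2)^(j-2) as a
  -- multiple of (1/2)^j.
  have hg1 := (summable_largePrime_inv_pow (P := P) le_rfl).mul_left (32 / 5 * M * β ^ 2)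
  have hg2 : Summable fun j : ℕ => (1 / 2 : ℝ) ^ j :=
    summable_geometric_of_lt_one (by norm_num) (by norm_num)
  refine .of_norm_bounded (hg1.mul_of_nonneg hg2 (fun p => by positivity)
    fun j => by positivity) ?_
  rintro ⟨p, j⟩
  rw [Real.norm_eq_abs, abs_mul]
  match j with
  | 0 => simp [wittExp_zero]; positivity
  | 1 => simp [wittExp_one_eq hF0 hG0 hX]; positivity
  | i + 2 =>
    have hc := abs_wittExp_sub_le_of_two_le hβ hβF hβG (show 2 ≤ i + 2 by omega)
    have hl := p.neg_log_le hP4 (show 2 ≤ i + 2 by omega)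
    have hl0 := p.neg_log_nonneg hP4 (show 2 ≤ i + 2 by omega)
    have hite : |if IsGenerator p.1 B then -Real.log (1 - 1 / (p.1 : ℝ) ^ (i + 2)) else 0| ≤
        16 / 15 * (1 / (p.1 : ℝ) ^ (i + 2)) := by
      split_ifs
      · rwa [abs_of_nonneg hl0]
      · rw [abs_zero]; positivity
    have hx : (β * (1 / (p.1 : ℝ))) ^ i ≤ (1 / 2) ^ i :=
      pow_le_pow_left₀ (by positivity) (mul_inv_prime_le hβ hP p) i
    calc _ ≤ 3 / 2 * M * β ^ (i + 2) * (16 / 15 * (1 / (p.1 : ℝ) ^ (i + 2))) :=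
          mul_le_mul hc hite (abs_nonneg _) (by positivity)
      _ = 8 / 5 * M * β ^ 2 * (1 / (p.1 : ℝ) ^ 2) * (β * (1 / (p.1 : ℝ))) ^ i := by
          rw [mul_pow, pow_add, pow_add, div_pow, one_pow, ← one_div_mul_one_div]
          ring
      _ ≤ 8 / 5 * M * β ^ 2 * (1 / (p.1 : ℝ) ^ 2) * (1 / 2) ^ i :=
          mul_le_mul_of_nonneg_left hx (by positivity)
      _ = _ := by rw [pow_add]; ring

open Classical in
-- Both series are iterated sums of one absolutely convergent double series over primes and j, taken
-- in the two orders.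
theorem exists_hasSum_log_quotient (B : CyclicSubgroup q) : ∃ Λ : ℝ,
    HasSum (fun p : LargePrime P => if IsGenerator p.1 B then
      Real.log (F.eval (1 / (p.1 : ℝ)) / G.eval (1 / (p.1 : ℝ))) else 0) Λ ∧
    HasSum (fun j : ℕ => (wittExp G j - wittExp F j) * classTail P B j) Λ := by
  have hsum := summable_wittExp_sub_mul (P := P) hβ hP hF0 hG0 hX hβF hβG B
  refine ⟨_, hsum.hasSum.prod_fiberwise fun p => ?_,
    ((Equiv.prodComm _ _).hasSum_iff.2 hsum.hasSum).prod_fiberwise fun j => ?_⟩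
  · split_ifs
    · simp only [← one_div_pow]
      exact hasSum_wittExp_sub hβ hβF hβG hF0 hG0 (by positivity) (mul_inv_prime_le hβ hP p)
    · simp
  · match j with
    | 0 => simp [wittExp_zero]
    | 1 => simp [wittExp_one_eq hF0 hG0 hX]
    | i + 2 => exact (summable_classTail (by linarith) (by omega) B).hasSum.mul_left _

theorem exists_hasProd_quotient (A : LatticeClass q) : ∃ Λ : ℝ,
    HasProd (fun p : PrimesIn P A => F.eval (1 / (p.1 : ℝ)) / G.eval (1 / (p.1 : ℝ)))
      (Real.exp Λ) ∧
    HasSum (fun j : ℕ => (wittExp G j - wittExp F j) * classTail P A.span j) Λ := by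
  classical
  obtain ⟨Λ, h1, h2⟩ := exists_hasSum_log_quotient (P := P) hβ hP hF0 hG0 hX hβF hβG A.span
  refine ⟨Λ, ?_, h2⟩
  have hgen : ∀ p : ℕ, IsGenerator p A.span ↔ ∃ a ∈ A.1, (a : ZMod q) = (p : ZMod q) := by
    intro p
    rw [IsGenerator, ← A.exists_eq_generators]
  let e : PrimesIn P A → LargePrime P := fun p => ⟨p.1, p.2.1, p.2.2.1⟩
  have he : Function.Injective e := fun p p' h => Subtype.ext (congrArg (fun x => x.1) h)
  rw [← he.hasSum_iff] at h1
  · have hfun : (fun p : PrimesIn P A => F.eval (1 / (p.1 : ℝ)) / G.eval (1 / (p.1 : ℝ))) =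
        Real.exp ∘ ((fun p : LargePrime P => if IsGenerator p.1 A.span then
          Real.log (F.eval (1 / (p.1 : ℝ)) / G.eval (1 / (p.1 : ℝ))) else 0) ∘ e) := by
      funext p
      have hx := mul_inv_prime_le hβ hP (e p)
      have hF := eval_pos hF0 hβ hβF (by positivity) hx
      have hG := eval_pos hG0 hβ hβG (by positivity) hx
      rw [Function.comp_apply, Function.comp_apply, if_pos ((hgen _).2 p.2.2.2),
        Real.exp_log (div_pos hF hG)]
    rw [hfun]
    exact h1.rexp
  · intro p hp
    rw [if_neg]
    intro h
    exact hp ⟨⟨p.1, p.2.1, p.2.2, (hgen _).1 h⟩, rfl⟩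

end Series

section Bounds

variable {F G : ℝ[X]} {β P : ℝ} (hβ : 2 ≤ β) (hP : 2 * β ≤ P)
  (hβF : ∀ ρ ∈ F.aroots ℂ, ‖ρ⁻¹‖ ≤ β) (hβG : ∀ ρ ∈ G.aroots ℂ, ‖ρ⁻¹‖ ≤ β)
include hβ hP hβF hβG

theorem abs_tsum_tail_le [NeZero q] (B : CyclicSubgroup q) {J : ℕ} (hJ : 3 ≤ J) :
    |∑' i : ℕ, (wittExp G (i + (J + 1)) - wittExp F (i + (J + 1))) *
      classTail P B (i + (J + 1))| ≤
    max (F.natDegree : ℝ) G.natDegree * (4 * β ^ (J + 1) / (J * P ^ J)) := by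
  have hP4 : 4 ≤ P := by linarith
  set M := max (F.natDegree : ℝ) G.natDegree
  have hJ' : (3 : ℝ) ≤ J := by exact_mod_cast hJ
  have hT0 := primeTail_nonneg hP4 (show 2 ≤ J + 1 by omega)
  have hterm : ∀ i : ℕ, ‖(wittExp G (i + (J + 1)) - wittExp F (i + (J + 1))) *
      classTail P B (i + (J + 1))‖ ≤
      4 * M * β ^ (J + 1) / (J + 1) * primeTail P (J + 1) * (1 / 2) ^ i := by
    intro i
    have hc := abs_wittExp_sub_le hβ hβF hβG (i + (J + 1))
    have hu : 2 ≤ i + (J + 1) := by omega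
    have hB := classTail_nonneg hP4 hu B
    have hT : classTail P B (i + (J + 1)) ≤ 1 / P ^ i * primeTail P (J + 1) := by
      refine (Finset.single_le_sum (fun B _ => classTail_nonneg hP4 hu B)
        (Finset.mem_univ B)).trans ((sum_classTail_le hP4 hu).trans ?_)
      rw [add_comm]
      exact primeTail_add_le hP4 (by omega) i
    have hx : (β * (1 / P)) ^ i ≤ (1 / 2) ^ i := by
      refine pow_le_pow_left₀ (by positivity) ?_ i
      rw [mul_one_div, div_le_div_iff₀ (by linarith) (by norm_num)]
      linarith
    have hc' : |wittExp G (i + (J + 1)) - wittExp F (i + (J + 1))| ≤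
        4 * M * β ^ (i + (J + 1)) / (J + 1) := by
      refine hc.trans (div_le_div_of_nonneg_left (by positivity) (by positivity) ?_)
      push_cast
      have := i.cast_nonneg (α := ℝ)
      linarith
    rw [Real.norm_eq_abs, abs_mul, abs_of_nonneg hB]
    calc _ ≤ 4 * M * β ^ (i + (J + 1)) / (J + 1) * (1 / P ^ i * primeTail P (J + 1)) :=
          mul_le_mul hc' hT hB (by positivity)
      _ = 4 * M * β ^ (J + 1) / (J + 1) * primeTail P (J + 1) * (β * (1 / P)) ^ i := by
          rw [pow_add, mul_pow, div_pow, one_pow]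
          ring
      _ ≤ _ := mul_le_mul_of_nonneg_left hx (by positivity)
  have hgeom : HasSum (fun i : ℕ => (1 / 2 : ℝ) ^ i) 2 := hasSum_geometric_two
  have h := tsum_of_norm_bounded (hgeom.mul_left _) hterm
  rw [Real.norm_eq_abs] at h
  refine h.trans ?_
  have hJ1 := primeTail_le hP4 (show 1 ≤ J by omega)
  calc 4 * M * β ^ (J + 1) / (J + 1) * primeTail P (J + 1) * 2
      ≤ 4 * M * β ^ (J + 1) / (J + 1) * (16 / 15 * (1 / P ^ (J + 1) * (1 + P / J))) * 2 := by
        gcongr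
    _ = M * (4 * β ^ (J + 1) / (J * P ^ J)) * (32 / 15 * (J * (1 / P) + 1) / (J + 1)) := by
        have : P ≠ 0 := by linarith
        rw [pow_succ P]
        field_simp
        ring
    _ ≤ M * (4 * β ^ (J + 1) / (J * P ^ J)) * 1 := by
        refine mul_le_mul_of_nonneg_left ?_ (by positivity)
        -- With P ≥ 4 the inequality 32(J/P + 1) ≤ 15(J + 1) follows from 7J ≥ 17, which is where J
        -- ≥ 3 enters.
        have hP' : 1 / P ≤ 1 / 4 := one_div_le_one_div_of_le (by norm_num) hP4
        rw [div_le_one (by positivity)]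
        nlinarith
    _ = _ := mul_one _

/-- Raising j by 1 multiplies the bound by β/P^(2^r) ≤ 1/16, so j = 2 dominates and yields the
exponent 2^(r+1) of P. The constants multiply to 3/2 · 8/15 · (16/15)² = 1024/1125 < 1. -/
theorem sum_abs_approx_sub_le [NeZero q] (B : CyclicSubgroup q) (J : ℕ) {r : ℕ} (hr : 2 ≤ r) :
    ∑ j ∈ Finset.Icc 2 J, |(wittExp G j - wittExp F j) *
      (classTail P B j - approxVec q P (j : ℝ) r B)| ≤
    max (F.natDegree : ℝ) G.natDegree *
      (((Nat.card (LatticeClass q) : ℝ) * ((expG q).divisors.card : ℝ) / 2) ^ (r - 1) *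
        ((r : ℝ) * β ^ 2 / P ^ (2 ^ (r + 1))) * (1 + P / 2 ^ r)) := by
  have hP4 : 4 ≤ P := by linarith
  set M := max (F.natDegree : ℝ) G.natDegree
  obtain ⟨s, rfl⟩ : ∃ s, r = s + 1 := ⟨r - 1, by omega⟩
  rw [card_latticeClass, Nat.add_sub_cancel]
  set Y := ((Fintype.card (CyclicSubgroup q) : ℝ) * (expG q).divisors.card / 2) ^ s
  have h4 : 4 ≤ 2 ^ (s + 1) :=
    calc 4 = 2 ^ 2 := rfl
      _ ≤ 2 ^ (s + 1) := Nat.pow_le_pow_right (by norm_num) hr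
  set T := primeTail P (2 ^ (s + 1) * 2) with hTdef
  have hT0 : 0 ≤ T := primeTail_nonneg hP4 (by omega)
  have hratio : β * (1 / P ^ 2 ^ (s + 1)) ≤ 1 / 16 := by
    have h1 : P ^ 4 ≤ P ^ 2 ^ (s + 1) := pow_le_pow_right₀ (by linarith) h4
    have h2 : (4 : ℝ) ^ 3 ≤ P ^ 3 := pow_le_pow_left₀ (by norm_num) hP4 3
    rw [mul_one_div, div_le_div_iff₀ (by positivity) (by norm_num)]
    nlinarith
  have hterm : ∀ i : ℕ, |(wittExp G (2 + i) - wittExp F (2 + i)) *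
      (classTail P B (2 + i) - approxVec q P ((2 + i : ℕ) : ℝ) (s + 1) B)| ≤
      4 / 5 * M * β ^ 2 * (s + 1) * Y * T * (1 / 16) ^ i := by
    intro i
    have hc := abs_wittExp_sub_le_of_two_le hβ hβF hβG (show 2 ≤ 2 + i by omega)
    have ha := abs_approxVec_sub_le hP4 (show 2 ≤ 2 + i by omega) s B
    have hT : primeTail P (2 ^ (s + 1) * (2 + i)) ≤ 1 / P ^ (2 ^ (s + 1) * i) * T := by
      rw [mul_add]
      exact primeTail_add_le hP4 (by omega) _
    rw [abs_mul, abs_sub_comm (classTail P B (2 + i))]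
    calc _ ≤ 3 / 2 * M * β ^ (2 + i) * ((s + 1) * (Y * (8 / 15 *
            (1 / P ^ (2 ^ (s + 1) * i) * T)))) := by
          refine mul_le_mul hc (ha.trans ?_) (abs_nonneg _) (by positivity)
          gcongr
      _ = 4 / 5 * M * β ^ 2 * (s + 1) * Y * T * (β * (1 / P ^ 2 ^ (s + 1))) ^ i := by
          rw [pow_add, mul_pow, div_pow, one_pow, ← pow_mul]
          ring
      _ ≤ _ := mul_le_mul_of_nonneg_left (pow_le_pow_left₀ (by positivity) hratio i)
          (by positivity)
  have hgeom : HasSum (fun i : ℕ => (1 / 16 : ℝ) ^ i) (16 / 15) := by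
    convert hasSum_geometric_of_lt_one (r := (1 / 16 : ℝ)) (by norm_num) (by norm_num) using 1
    norm_num
  have hT : T ≤ 16 / 15 * (1 / P ^ 2 ^ (s + 1 + 1) * (1 + P / 2 ^ (s + 1))) := by
    -- The tail bound at exponent m + 1 = 2^(r+1) has P/m; since m ≥ 2^r, this is at most P/2^r.
    obtain ⟨m, hm⟩ : ∃ m, 2 ^ (s + 1) * 2 = m + 1 := ⟨2 ^ (s + 1) * 2 - 1, by omega⟩
    have hle : ((2 : ℝ) ^ (s + 1)) ≤ m := by
      have : 2 ^ (s + 1) ≤ m := by omega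
      exact_mod_cast this
    have h := primeTail_le hP4 (show 1 ≤ m by omega)
    rw [hTdef, pow_succ 2 (s + 1), hm]
    refine h.trans ?_
    gcongr
  calc _ = ∑ i ∈ Finset.range (J + 1 - 2), |(wittExp G (2 + i) - wittExp F (2 + i)) *
      (classTail P B (2 + i) - approxVec q P ((2 + i : ℕ) : ℝ) (s + 1) B)| := by
        rw [← Finset.sum_Ico_eq_sum_range (fun j : ℕ => |(wittExp G j - wittExp F j) *
          (classTail P B j - approxVec q P (j : ℝ) (s + 1) B)|)]
        rfl
    _ ≤ ∑ i ∈ Finset.range (J + 1 - 2), 4 / 5 * M * β ^ 2 * (s + 1) * Y * T * (1 / 16) ^ i :=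
        Finset.sum_le_sum fun i _ => hterm i
    _ ≤ 4 / 5 * M * β ^ 2 * (s + 1) * Y * T * (16 / 15) := by
        rw [← Finset.mul_sum]
        exact mul_le_mul_of_nonneg_left (sum_le_hasSum _ (fun i _ => by positivity) hgeom)
          (by positivity)
    _ ≤ 4 / 5 * M * β ^ 2 * (s + 1) * Y *
          (16 / 15 * (1 / P ^ 2 ^ (s + 1 + 1) * (1 + P / 2 ^ (s + 1)))) * (16 / 15) := by
        gcongr
    _ = 1024 / 1125 * (M * (Y * ((s + 1) * β ^ 2 / P ^ 2 ^ (s + 1 + 1)) *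
          (1 + P / 2 ^ (s + 1)))) := by ring
    _ ≤ M * (Y * ((s + 1) * β ^ 2 / P ^ 2 ^ (s + 1 + 1)) * (1 + P / 2 ^ (s + 1))) :=
        mul_le_of_le_one_left (by positivity) (by norm_num)
    _ = _ := by push_cast; ring

end Bounds

end EulerProd

theorem mainTheorem2 (q : ℕ) [NeZero q] (hq : 1 < q) (A : EulerProd.LatticeClass q)
    (F G : Polynomial ℝ) (hFG : IsCoprime F G)
    (hF0 : F.eval 0 = 1) (hG0 : G.eval 0 = 1) (hX : Polynomial.X ^ 2 ∣ F - G)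
    (β : ℝ) (hβ : 2 ≤ β)
    (hβF : ∀ ρ ∈ F.aroots ℂ, ‖ρ⁻¹‖ ≤ β) (hβG : ∀ ρ ∈ G.aroots ℂ, ‖ρ⁻¹‖ ≤ β)
    (P : ℝ) (hP : 2 * β ≤ P) (J r : ℕ) (hJ : 3 ≤ J) (hr : 2 ≤ r) :
    Multipliable (fun p : EulerProd.PrimesIn P A =>
      F.eval (1 / (p.1 : ℝ)) / G.eval (1 / (p.1 : ℝ))) ∧
    ∃ I : ℝ, 0 < I ∧
      ∏' p : EulerProd.PrimesIn P A, F.eval (1 / (p.1 : ℝ)) / G.eval (1 / (p.1 : ℝ)) =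
        (∏ j ∈ Finset.Icc 2 J,
          EulerProd.zetaApprox P (j : ℝ) A r ^
            (EulerProd.wittExp G j - EulerProd.wittExp F j)) * I ∧
      |Real.log I| ≤
        (max F.natDegree G.natDegree : ℝ) *
          (((Nat.card (EulerProd.LatticeClass q) : ℝ) *
                ((EulerProd.expG q).divisors.card : ℝ) / 2) ^ (r - 1) *
              ((r : ℝ) * β ^ 2 / P ^ (2 ^ (r + 1))) * (1 + P / 2 ^ r) +
            4 * β ^ (J + 1) / ((J : ℝ) * P ^ J)) := by
  open EulerProd in
  have hP4 : 4 ≤ P := by linarith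
  obtain ⟨Λ, hprod, hsum⟩ := exists_hasProd_quotient hβ hP hF0 hG0 hX hβF hβG A
  -- I is the quotient forced by the identity. Its logarithm is the approximation error for 2 ≤ j ≤
  -- J plus the tail j > J, estimated separately below.
  refine ⟨hprod.multipliable, Real.exp (Λ - ∑ j ∈ Finset.Icc 2 J,
    (wittExp G j - wittExp F j) * approxVec q P (j : ℝ) r A.span), Real.exp_pos _, ?_, ?_⟩
  · have hz : ∀ j : ℕ, zetaApprox P (j : ℝ) A r ^ (wittExp G j - wittExp F j) =
        Real.exp ((wittExp G j - wittExp F j) * approxVec q P (j : ℝ) r A.span) := fun j => by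
      rw [zetaApprox, ← Real.exp_mul, mul_comm]
    rw [hprod.tprod_eq, Finset.prod_congr rfl fun j _ => hz j, ← Real.exp_sum, ← Real.exp_add,
      add_sub_cancel]
  · rw [Real.log_exp, mul_add]
    have hsplit := hsum.summable.sum_add_tsum_nat_add (J + 1)
    have hIcc : ∑ j ∈ Finset.range (J + 1),
        (wittExp G j - wittExp F j) * classTail P A.span j =
        ∑ j ∈ Finset.Icc 2 J, (wittExp G j - wittExp F j) * classTail P A.span j := by
      symm
      refine Finset.sum_subset (fun j hj => ?_) fun j hj hj' => ?_
      · rw [Finset.mem_Icc] at hj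
        exact Finset.mem_range.2 (by omega)
      · rw [Finset.mem_range] at hj
        rw [Finset.mem_Icc] at hj'
        obtain rfl | rfl : j = 0 ∨ j = 1 := by omega
        · simp [wittExp_zero]
        · simp [wittExp_one_eq hF0 hG0 hX]
    rw [hsum.tsum_eq, hIcc] at hsplit
    have h1 := sum_abs_approx_sub_le (q := q) hβ hP hβF hβG A.span J hr
    have h2 := abs_tsum_tail_le hβ hP hβF hβG A.span hJ
    rw [← hsplit, add_sub_right_comm, ← Finset.sum_sub_distrib]
    simp only [← mul_sub]
    exact (abs_add_le _ _).trans (add_le_add ((Finset.abs_sum_le_sum_abs _ _).trans h1) h2)
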